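/- **Setting.** A barrier is a segment $[0,L]$, $L>0$. There are $n$ sensors at positions $0\le x_1\le\dots\le x_n\le L$, all of range $r>0$, with $2rn\ge L$; a sensor at $y$ covers $[y-r,y+r]$. Coverage is complete if every point of $[0,L]$ is covered. A robot starts at $0$. Its trajectory is a finite sequence $[t_0=0,t_1,\dots,t_N]$ of points of $[0,L]$ with $t_i>t_{i-1}$ for odd $i$ and $t_i<t_{i-1}$ for even $i$ (empty, with $N=0$, if it does not move); its length is $\sum_i|t_i-t_{i-1}|$, and $t_N$ is its termination point. While following it, the robot can pick up any sensors at its current point, carry any number of them, and drop them anywhere. A trajectory is *optimal* if it allows the robot to reach complete coverage and has minimum length among all trajectories that do. Final positions $y_1,\dots,y_n$ are *order-preserving* if $y_1\le\dots\le y_n$, and *fully stretched* if $y_i=(2i-1)r$ whenever $y_i<t_N$ (sensors at or after the termination point are exempt). **Algorithm Offline.** Let $C_i=(2ri-r)-x_i$ be the coverage balance of sensor $i$. 1. If coverage is complete initially, output the empty trajectory. 2. Otherwise let $k$ be the smallest integer such that sensors $k+1,\dots,n$, left in place, cover every point of $[0,L]$ to the right of $2rk$. Let $c=x_k$ if $C_k<0$;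 otherwise let $c=g-r$, where $g$ is the supremum of the points of $[0,L]$ not covered by sensors $k+1,\dots,n$. 3. Let $a_1<\dots<a_m$ be the indices $a$ with $-2r<C_a<0$, or with $C_a=-2r$, $a<n$ and $x_a=x_{a+1}$. With $a_0=0$, let $b_i$ be the smallest index $b>a_{i-1}$ with $C_b<0$. The pairs $(b_i,a_i)$ are the potential triple delimiters; put $\ell_i=x_{b_i}+C_{b_i}$. 4. For $0\le j\le m$ let $T_j$ be the trajectory with points $x_{a_1},\ell_1,\dots,x_{a_j},\ell_j$ followed by $c,\ell_{j+1}$ if $j<m$, and by $c$ if $j=m$. Its overhead is $o_j=\sum_{i\le j}2(x_{a_i}-\ell_i)$, plus $c-\ell_{j+1}$ if $j<m$. 5. Output $T_j$ for the least $j\in\{0,\dots,m\}$ that minimizes $o_j$. **Theorem.** Algorithm Offline computes an optimal trajectory in $O(n)$ time. More precisely: * There are a program for the unit-cost real RAM (finitely many instructions: addition, subtraction, comparison and constants for natural-number index registers; $+,-,\times,/$, comparison and integer constants for real memory cells, addressed indirectly; output) and a constant $K$ such that on every input $n,L,r,x_1,\dots,x_n$ the program halts after at most $Kn$ steps, and its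 output is that of Offline. * For every input, the output of Offline is an optimal trajectory, and by following it the robot can reach final positions that give complete coverage and are order-preserving and fully stretched. * If coverage is not complete initially, the output is $T_j$ for some $0\le j\le m$ with $o_j=\min_i o_i$, and its length is $c+o_j$. It consists of triples on the segments $[\ell_i,x_{a_i}]$, $1\le i\le j$, and straight segments, and it ends with a double on $[\ell_{j+1},c]$ if $j<m$, and with a straight segment to $c$ if $j=m$. These segments are pairwise disjoint: $0<\ell_1<x_{a_1}<\ell_2<\dots<\ell_j<x_{a_j}$, followed by $<\ell_{j+1}<c$ if $j<m$, and by $<c$ if $j=m$. -/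

import Mathlib

noncomputable section

namespace BarrierRobot

/-! ### Problem instances -/

/-- An instance: `n` sensors `1, …, n` of common range `r` at positions
`x 1 ≤ x 2 ≤ … ≤ x n` of the barrier `[0, L]`, whose total range suffices to cover `[0, L]`.
Values of `x` outside `1, …, n` are never used. -/
structure Barrier where
  n : ℕ
  L : ℝ
  r : ℝ
  x : ℕ → ℝ
  L_pos : 0 < L
  r_pos : 0 < r
  x_mem : ∀ i ∈ Set.Icc 1 n, x i ∈ Set.Icc 0 L
  x_mono : MonotoneOn x (Set.Icc 1 n)
  enough : L ≤ 2 * r * n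

/-- Sensors `1, …, n` of range `r` at the positions `y 1, …, y n` leave no gap in `[0, L]`. -/
def Barrier.Covered (I : Barrier) (y : ℕ → ℝ) : Prop :=
  ∀ p ∈ Set.Icc 0 I.L, ∃ i ∈ Set.Icc 1 I.n, p ∈ Set.Icc (y i - I.r) (y i + I.r)

/-! ### The robot: configurations, moves, trajectories -/

/-- Position of the robot and positions of the sensors. -/
structure Config where
  pos : ℝ
  loc : ℕ → ℝ

open Classical in
/-- The robot goes straight to `q`, carrying the sensors in `S`, and leaving all others where
they are. -/
def Config.carry (c : Config) (q : ℝ) (S : Set ℕ) : Config where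
  pos := q
  loc := fun i => if i ∈ S then q else c.loc i

/-- `Sweep t c c'`: the robot, in configuration `c`, goes straight to the point `t`. It may
stop at any number of points on the way; at each of them it picks up, keeps or drops
any number of the sensors that are at that point (`S` is the set it takes with it). -/
inductive Sweep (t : ℝ) : Config → Config → Prop
  | done (c : Config) : c.pos = t → Sweep t c c
  | leg (c c' : Config) (q : ℝ) (S : Set ℕ) :
      q ∈ Set.uIcc c.pos t → (∀ i ∈ S, c.loc i = c.pos) →
      Sweep t (c.carry q S) c' → Sweep t c c'

/-- `Run ts c c'`: following the trajectory with the successive points `ts`, the robot can bring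
configuration `c` into configuration `c'`. -/
inductive Run : List ℝ → Config → Config → Prop
  | nil (c : Config) : Run [] c c
  | cons (t : ℝ) (ts : List ℝ) (c c' c'' : Config) :
      Sweep t c c' → Run ts c' c'' → Run (t :: ts) c c''

/-- The points of the list, read from `p`, go alternately to the right and to the left; the flag
says whether the next move is to the right. -/
def Alternating : Bool → ℝ → List ℝ → Prop
  | _, _, [] => True
  | true, p, t :: ts => p < t ∧ Alternating false t ts
  | false, p, t :: ts => t < p ∧ Alternating true t ts

/-- Length of the path that starts at `p` and visits the points of the list in order. -/
def pathLength : ℝ → List ℝ → ℝ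
  | _, [] => 0
  | p, t :: ts => |t - p| + pathLength t ts

/-- The list `[t₁, …, t_m]` is a trajectory `[t₀ = 0, t₁, …, t_m]`: its points are on the barrier,
`t_i > t_{i-1}` for odd `i`, and `t_i < t_{i-1}` for even `i`. The empty list is the trajectory of
a robot that does not move. -/
def Barrier.IsTrajectory (I : Barrier) (ts : List ℝ) : Prop :=
  (∀ t ∈ ts, t ∈ Set.Icc 0 I.L) ∧ Alternating true 0 ts

/-- The trajectory allows the robot, starting at `0`, to bring the sensors from their initial
positions to the positions `y`. -/
def Barrier.Produces (I : Barrier) (ts : List ℝ) (y : ℕ → ℝ) : Prop :=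
  ∃ c' : Config, Run ts ⟨0, I.x⟩ c' ∧ c'.loc = y

/-- The trajectory allows the robot to restore complete coverage. -/
def Barrier.Restores (I : Barrier) (ts : List ℝ) : Prop :=
  ∃ y, I.Produces ts y ∧ I.Covered y

/-- A trajectory of minimum length among those that restore coverage. -/
def Barrier.IsOptimal (I : Barrier) (ts : List ℝ) : Prop :=
  I.IsTrajectory ts ∧ I.Restores ts ∧
    ∀ ts', I.IsTrajectory ts' → I.Restores ts' → pathLength 0 ts ≤ pathLength 0 ts'

/-- Final positions in the same order as the initial ones. -/
def Barrier.OrderPreserving (I : Barrier) (y : ℕ → ℝ) : Prop :=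
  MonotoneOn y (Set.Icc 1 I.n)

/-- The termination point of a trajectory. -/
def termination (ts : List ℝ) : ℝ := ts.getLastD 0

/-- All sensors that end up before the termination point of the trajectory are in
attached positions: the first one at distance `r` from `0`, consecutive ones at distance `2r`. -/
def Barrier.FullyStretched (I : Barrier) (ts : List ℝ) (y : ℕ → ℝ) : Prop :=
  ∀ i ∈ Set.Icc 1 I.n, y i < termination ts → y i = 2 * I.r * i - I.r

/-! ### Algorithm Offline: what it computes -/

/-- The coverage balance of sensor `i`. -/
def Barrier.balance (I : Barrier) (i : ℕ) : ℝ := (2 * I.r * i - I.r) - I.x i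

/-- The points of the barrier that are not covered by the sensors `k + 1, …, n` in their initial
positions. -/
def Barrier.uncoveredAfter (I : Barrier) (k : ℕ) : Set ℝ :=
  {p ∈ Set.Icc 0 I.L | ∀ i ∈ Set.Icc (k + 1) I.n, p ∉ Set.Icc (I.x i - I.r) (I.x i + I.r)}

/-- The least `k` such that the sensors `k + 1, …, n`, left in place, leave no gap to the right
of `2rk`. -/
def Barrier.lastMoved (I : Barrier) : ℕ :=
  sInf {k : ℕ | ∀ p ∈ I.uncoveredAfter k, p ≤ 2 * I.r * k}

open Classical in
/-- The rightmost point `c` of the trajectory. With `k = lastMoved`: the position of sensor `k` if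
its balance is negative, and otherwise the point from which a sensor reaches just as far as the
right end of the last gap left by the sensors `k + 1, …, n`. -/
def Barrier.farPoint (I : Barrier) : ℝ :=
  if I.balance I.lastMoved < 0 then I.x I.lastMoved
  else sSup (I.uncoveredAfter I.lastMoved) - I.r

/-- Sensor `a` is at a potential left-turning point. -/
def Barrier.IsLeftTurn (I : Barrier) (a : ℕ) : Prop :=
  (-2 * I.r < I.balance a ∧ I.balance a < 0) ∨
    (I.balance a = -2 * I.r ∧ a < I.n ∧ I.x a = I.x (a + 1))

open Classical in
/-- The indices `a₁ < a₂ < ⋯ < a_m` of the sensors at potential left-turning points. -/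
def Barrier.leftTurns (I : Barrier) : List ℕ :=
  (List.range' 1 I.n).filter (fun a => decide (I.IsLeftTurn a))

/-- Pairs each index `a` of the list with the least index `b` of a sensor of negative balance
that is larger than the index before `a` (which is `prev` for the head of the list). -/
def Barrier.pairUp (I : Barrier) : ℕ → List ℕ → List (ℕ × ℕ)
  | _, [] => []
  | prev, a :: as =>
      (sInf {b : ℕ | prev < b ∧ b ≤ I.n ∧ I.balance b < 0}, a) :: I.pairUp a as

/-- The list `[(b₁, a₁), …, (b_m, a_m)]` of potential triple delimiters. -/
def Barrier.delimiters (I : Barrier) : List (ℕ × ℕ) := I.pairUp 0 I.leftTurns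

/-- The right-turning point that belongs to index `b`. -/
def Barrier.rightTurn (I : Barrier) (b : ℕ) : ℝ := I.x b + I.balance b

/-- The trajectory `T_j`: triples `[x_b + C_b, x_a]` at the first `j` delimiters, and then,
if `j < m`, a double that turns left at `c` and ends at the right-turning point of the next
delimiter; if `j = m`, a straight line segment that ends at `c`. -/
def Barrier.trajectory (I : Barrier) (j : ℕ) : List ℝ :=
  (I.delimiters.take j).flatMap (fun p => [I.x p.2, I.rightTurn p.1]) ++
    match I.delimiters[j]? with
    | some p => [I.farPoint, I.rightTurn p.1]
    | none => [I.farPoint]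

/-- The end points of the triples of `T_j`, from left to right, followed by those of its double,
or by its termination point if there is no double. -/
def Barrier.breakpoints (I : Barrier) (j : ℕ) : List ℝ :=
  (I.delimiters.take j).flatMap (fun p => [I.rightTurn p.1, I.x p.2]) ++
    match I.delimiters[j]? with
    | some p => [I.rightTurn p.1, I.farPoint]
    | none => [I.farPoint]

/-- The overhead of `T_j` over the straight line trajectory from `0` to `c`. -/
def Barrier.overhead (I : Barrier) (j : ℕ) : ℝ :=
  (match I.delimiters[j]? with
    | some p => I.farPoint - I.rightTurn p.1
    | none => 0) +
    ((I.delimiters.take j).map (fun p => 2 * (I.x p.2 - I.rightTurn p.1))).sum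

/-- The least index in `0, …, m` of minimum overhead. -/
def Barrier.bestIndex (I : Barrier) : ℕ :=
  sInf {j : ℕ | j ≤ I.delimiters.length ∧
    ∀ i ≤ I.delimiters.length, I.overhead j ≤ I.overhead i}

open Classical in
/-- The output of Algorithm Offline. -/
def Barrier.offline (I : Barrier) : List ℝ :=
  if I.Covered I.x then [] else I.trajectory I.bestIndex

/-! ### The machine model: a real RAM with unit costs -/

/-- Instructions. There are registers for natural numbers, used for indices, and a memory of
real numbers. Real operands are always addressed through index registers: in the
instructions on reals, `d`, `a`, `b` stand for the memory cells whose addresses are in the index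
registers `d`, `a`, `b`. -/
inductive Instr
  | setIdx (d k : ℕ)
  | addIdx (d a b : ℕ)
  | subIdx (d a b : ℕ)
  | jumpIdxLE (a b target : ℕ)
  | setReal (d : ℕ) (q : ℤ)
  | addReal (d a b : ℕ)
  | subReal (d a b : ℕ)
  | mulReal (d a b : ℕ)
  | divReal (d a b : ℕ)
  | jumpRealLE (a b target : ℕ)
  | emit (a : ℕ)

/-- State of the machine: program counter, index registers, real memory, output. -/
structure State where
  pc : ℕ
  idx : ℕ → ℕ
  mem : ℕ → ℝ
  out : List ℝ

/-- Write a natural number into an index register and go on. -/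
def State.putIdx (s : State) (d v : ℕ) : State :=
  { s with pc := s.pc + 1, idx := Function.update s.idx d v }

/-- Write a real number into the cell addressed by the index register `d` and go on. -/
def State.putReal (s : State) (d : ℕ) (v : ℝ) : State :=
  { s with pc := s.pc + 1, mem := Function.update s.mem (s.idx d) v }

/-- The content of the cell addressed by the index register `a`. -/
def State.get (s : State) (a : ℕ) : ℝ := s.mem (s.idx a)

open Classical in
/-- Effect of one instruction. -/
def Instr.exec (s : State) : Instr → State
  | .setIdx d k => s.putIdx d k
  | .addIdx d a b => s.putIdx d (s.idx a + s.idx b)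
  | .subIdx d a b => s.putIdx d (s.idx a - s.idx b)
  | .jumpIdxLE a b l => { s with pc := if s.idx a ≤ s.idx b then l else s.pc + 1 }
  | .setReal d q => s.putReal d (q : ℝ)
  | .addReal d a b => s.putReal d (s.get a + s.get b)
  | .subReal d a b => s.putReal d (s.get a - s.get b)
  | .mulReal d a b => s.putReal d (s.get a * s.get b)
  | .divReal d a b => s.putReal d (s.get a / s.get b)
  | .jumpRealLE a b l => { s with pc := if s.get a ≤ s.get b then l else s.pc + 1 }
  | .emit a => { s with pc := s.pc + 1, out := s.out ++ [s.get a] }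

/-- One step of a program. The machine has halted when the program counter is outside
the program. -/
def step (P : List Instr) (s : State) : State :=
  match P[s.pc]? with
  | some instr => instr.exec s
  | none => s

/-- The input: `n` in index register `0`, then `L, r, x 1, …, x n` in the cells `0, …, n + 1`;
everything else is `0`, and the output is empty. -/
def Barrier.input (I : Barrier) : State where
  pc := 0
  idx := fun i => if i = 0 then I.n else 0
  mem := fun a =>
    if a = 0 then I.L else if a = 1 then I.r else if a ≤ I.n + 1 then I.x (a - 1) else 0
  out := []

/-- On input `I`, the program halts after at most `T` steps with output `out`. -/
def Computes (P : List Instr) (I : Barrier) (out : List ℝ) (T : ℕ) : Prop :=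
  ∃ t ≤ T, P.length ≤ ((step P)^[t] I.input).pc ∧ ((step P)^[t] I.input).out = out

end BarrierRobot

end

/-! Lower bound. Let a restoring trajectory end at `e`. Its length is `e` plus twice its total
movement to the left (`pathLength_eq`), and that movement is at least the measure of the set `W` of
points crossed from right to left (`volume_leftCross_le`). So it suffices to know points that must
lie in `W`. The robot has to get as far as `c` (`exists_farPoint_le`), hence `W` contains `[e, c)`.
For every pair `(b, a)` of delimiters, `W` contains the open interval from `rightTurn b` to `x a`:
if `q` is never crossed to the left, the sensors to the right of `q` stay there, and the remaining
ones are too few to cover everything up to `q - r` (`leftCross_of_mem_Ioo`). Pairs to the left of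
`e` pay for triples, and the first pair that `e` does not pass pays, together with `[e, c)`, for a
double; so the length is at least `c` plus the overhead of some `T_j` (`exists_excess_le`).

Upper bound. All `T_j` lead to the same final positions: the first `lastMoved` sensors are attached,
truncated at `c`, and the others stay in place or are pulled up to `c` (`run_path`,
`final_covered`). This rests on the block structure `Delimits`: the sensors of negative balance fall
into blocks in which every sensor but the last has balance at most `-2r` (`neg_step`), with disjoint
segments. For the least overhead no triple reaches `c` (`excess_lt_of_neg`), so all breakpoints are
distinct.

Linear time. The delimiters are found in one pass (`pairUp_eq_scan`). The algorithm is a fixed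
sequence of four loops of `n` rounds each, written in a small structured language whose translation
into machine code is proved correct together with a step count. -/

noncomputable section

/-! ### Combinatorics of gaps, balances and delimiters -/

namespace BarrierRobot

open Set

namespace Barrier

variable (I : Barrier)

/-! ### Attached positions and balances -/

theorem rightTurn_eq (i : ℕ) : I.rightTurn i = 2 * I.r * i - I.r := by
  simp only [rightTurn, balance]; ring

theorem balance_eq (i : ℕ) : I.balance i = I.rightTurn i - I.x i := by
  simp only [rightTurn]; ring

theorem rightTurn_succ (i : ℕ) : I.rightTurn (i + 1) = I.rightTurn i + 2 * I.r := by
  simp only [rightTurn_eq]; push_cast; ring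

theorem rightTurn_mono {i j : ℕ} (h : i ≤ j) : I.rightTurn i ≤ I.rightTurn j := by
  have h1 : (i : ℝ) ≤ j := by exact_mod_cast h
  have := I.r_pos
  simp only [rightTurn_eq]; nlinarith

theorem rightTurn_pos {i : ℕ} (h : 1 ≤ i) : 0 < I.rightTurn i := by
  have := I.rightTurn_mono h
  have h1 := I.rightTurn_eq 1
  have := I.r_pos
  push_cast at h1; linarith

theorem x_le {i j : ℕ} (hi : 1 ≤ i) (hij : i ≤ j) (hj : j ≤ I.n) : I.x i ≤ I.x j :=
  I.x_mono ⟨hi, hij.trans hj⟩ ⟨hi.trans hij, hj⟩ hij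

theorem x_nonneg {i : ℕ} (hi : 1 ≤ i) (hj : i ≤ I.n) : 0 ≤ I.x i := (I.x_mem i ⟨hi, hj⟩).1

theorem x_le_L {i : ℕ} (hi : 1 ≤ i) (hj : i ≤ I.n) : I.x i ≤ I.L := (I.x_mem i ⟨hi, hj⟩).2

theorem one_le_n : 1 ≤ I.n := by
  by_contra h
  have h0 : I.n = 0 := by omega
  have := I.enough
  have := I.L_pos
  simp_all
  linarith

/-! ### The right end of the last gap left by a final segment of the sensors -/

/-- Recursion for `gapEnd`, with the number of sensors in the final segment as argument. -/
def gapEndAux : ℕ → ℝ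
  | 0 => I.L
  | t + 1 =>
    open Classical in
    if I.x (I.n - t) + I.r < gapEndAux t then gapEndAux t else I.x (I.n - t) - I.r

/-- The supremum of the points that the sensors `k + 1, …, n` do not cover, if this is positive;
if it is not, there are no such points. -/
def gapEnd (k : ℕ) : ℝ := I.gapEndAux (I.n - k)

theorem gapEnd_n : I.gapEnd I.n = I.L := by simp [gapEnd, gapEndAux]

open Classical in
theorem gapEnd_of_lt {k : ℕ} (hk : k < I.n) : I.gapEnd k =
    if I.x (k + 1) + I.r < I.gapEnd (k + 1) then I.gapEnd (k + 1) else I.x (k + 1) - I.r := by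
  have h1 : I.n - k = (I.n - (k + 1)) + 1 := by omega
  have h2 : I.n - (I.n - (k + 1)) = k + 1 := by omega
  rw [gapEnd, h1, gapEndAux, h2]; rfl

theorem backward_induction {n : ℕ} {P : ℕ → Prop} (hn : P n)
    (hs : ∀ k < n, P (k + 1) → P k) : ∀ k ≤ n, P k := by
  intro k hk
  obtain ⟨d, rfl⟩ := Nat.exists_eq_add_of_le hk
  clear hk
  induction d generalizing k with
  | zero => exact hn
  | succ d ih =>
    refine hs k (by omega) (ih (k + 1) ?_ ?_)
    · rwa [show k + 1 + d = k + (d + 1) by omega]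
    · intro j hj; exact hs j (by omega)

/-- Sensor `k + 1` is the leftmost of its segment: if it reaches the last gap, it closes everything
from its own left end on. Ranges are closed, so the supremum is itself uncovered only when it is the
end `L` of the barrier; `covered_iff` needs this to treat the point `0` when `gapEnd 0 ≤ 0`. -/
theorem le_gapEnd_of_mem {k : ℕ} (hk : k ≤ I.n) :
    ∀ p ∈ I.uncoveredAfter k, p ≤ I.gapEnd k ∧ (p < I.gapEnd k ∨ I.gapEnd k = I.L) := by
  revert hk
  refine backward_induction (P := fun k => ∀ p ∈ I.uncoveredAfter k,
    p ≤ I.gapEnd k ∧ (p < I.gapEnd k ∨ I.gapEnd k = I.L)) ?_ ?_ k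
  · intro p hp
    rw [gapEnd_n]
    exact ⟨hp.1.2, Or.inr rfl⟩
  · intro k hk ih p hp
    have hp' : p ∈ I.uncoveredAfter (k + 1) :=
      ⟨hp.1, fun i hi => hp.2 i ⟨by have := hi.1; omega, hi.2⟩⟩
    have h1 := ih p hp'
    have h2 := hp.2 (k + 1) ⟨le_rfl, hk⟩
    rw [gapEnd_of_lt I hk]
    split_ifs with h
    · exact h1
    · have h3 : p < I.x (k + 1) - I.r := by
        by_contra h3
        exact h2 ⟨by linarith, by linarith [h1.1]⟩
      exact ⟨h3.le, Or.inl h3⟩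

theorem exists_mem_uncoveredAfter {k : ℕ} (hk : k ≤ I.n) :
    ∀ q, 0 ≤ q → q < I.gapEnd k → ∃ p ∈ I.uncoveredAfter k, q < p := by
  revert hk
  refine backward_induction (P := fun k => ∀ q, 0 ≤ q → q < I.gapEnd k →
    ∃ p ∈ I.uncoveredAfter k, q < p) ?_ ?_ k
  · intro q hq hqL
    rw [gapEnd_n] at hqL
    refine ⟨I.L, ⟨⟨I.L_pos.le, le_rfl⟩, ?_⟩, hqL⟩
    intro i hi
    have h1 := hi.1
    have h2 := hi.2
    omega
  · intro k hk ih q hq hqG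
    have hr := I.r_pos
    rw [gapEnd_of_lt I hk] at hqG
    split_ifs at hqG with h
    · have hx := I.x_nonneg (i := k + 1) (by omega) hk
      -- Asking for a point beyond `x (k + 1) + r` makes sure that sensor `k + 1` misses it too.
      obtain ⟨p, hp, hlt⟩ := ih (max q (I.x (k + 1) + I.r)) (le_max_of_le_left hq)
        (max_lt hqG h)
      rw [max_lt_iff] at hlt
      refine ⟨p, ⟨hp.1, fun i hi => ?_⟩, hlt.1⟩
      rcases eq_or_lt_of_le hi.1 with h1 | h1
      · rw [← h1]
        intro h2
        linarith [h2.2, hlt.2]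
      · exact hp.2 i ⟨h1, hi.2⟩
    · have hL := I.x_le_L (i := k + 1) (by omega) hk
      refine ⟨(q + (I.x (k + 1) - I.r)) / 2, ⟨⟨by linarith, by linarith⟩, fun i hi h2 => ?_⟩,
        by linarith⟩
      have h3 := I.x_le (by omega) hi.1 hi.2
      linarith [h2.1]

theorem gapEnd_le_L {k : ℕ} (hk : k ≤ I.n) : I.gapEnd k ≤ I.L := by
  by_contra! h
  obtain ⟨p, hp, h1⟩ := I.exists_mem_uncoveredAfter hk I.L I.L_pos.le h
  linarith [hp.1.2]

theorem sSup_uncoveredAfter {k : ℕ} (hk : k ≤ I.n) (h0 : 0 < I.gapEnd k) :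
    sSup (I.uncoveredAfter k) = I.gapEnd k := by
  refine csSup_eq_of_forall_le_of_forall_lt_exists_gt ?_
    (fun p hp => (I.le_gapEnd_of_mem hk p hp).1) ?_
  · obtain ⟨p, hp, -⟩ := I.exists_mem_uncoveredAfter hk 0 le_rfl h0
    exact ⟨p, hp⟩
  · intro w hw
    obtain ⟨p, hp, h⟩ := I.exists_mem_uncoveredAfter hk (max w 0) (le_max_right _ _)
      (max_lt hw h0)
    exact ⟨p, hp, (le_max_left _ _).trans_lt h⟩

theorem uncoveredAfter_le_iff {k : ℕ} (hk : k ≤ I.n) :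
    (∀ p ∈ I.uncoveredAfter k, p ≤ 2 * I.r * k) ↔ I.gapEnd k ≤ 2 * I.r * k := by
  have h0 : 0 ≤ 2 * I.r * k := by have := I.r_pos; positivity
  constructor
  · intro h
    by_contra! h1
    obtain ⟨p, hp, h2⟩ := I.exists_mem_uncoveredAfter hk _ h0 h1
    linarith [h p hp]
  · intro h p hp
    exact (I.le_gapEnd_of_mem hk p hp).1.trans h

/-! ### The number of sensors that have to be moved -/

theorem lastMoved_spec : I.lastMoved ≤ I.n ∧ I.gapEnd I.lastMoved ≤ 2 * I.r * I.lastMoved := by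
  have hn : I.n ∈ {k : ℕ | ∀ p ∈ I.uncoveredAfter k, p ≤ 2 * I.r * k} :=
    fun p hp => hp.1.2.trans I.enough
  have h1 : I.lastMoved ≤ I.n := Nat.sInf_le hn
  exact ⟨h1, (I.uncoveredAfter_le_iff h1).1 (Nat.sInf_mem ⟨_, hn⟩)⟩

theorem lastMoved_le_n : I.lastMoved ≤ I.n := I.lastMoved_spec.1

theorem lastMoved_le {k : ℕ} (hk : k ≤ I.n) (h : I.gapEnd k ≤ 2 * I.r * k) :
    I.lastMoved ≤ k :=
  Nat.sInf_le ((I.uncoveredAfter_le_iff hk).2 h)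

/-- By the recursion, leaving out one more sensor raises the gap end by at most its diameter `2r`,
exactly the growth of the right-hand side. So the test that defines `lastMoved` stays true once it
is true. -/
theorem gapEnd_le_of_lastMoved_le {k : ℕ} (h : I.lastMoved ≤ k) (hk : k ≤ I.n) :
    I.gapEnd k ≤ 2 * I.r * k := by
  induction k, h using Nat.le_induction with
  | base => exact I.lastMoved_spec.2
  | succ k h ih =>
    have h1 := ih (by omega)
    rw [gapEnd_of_lt I (by omega)] at h1
    have := I.r_pos
    push_cast
    split_ifs at h1 with h2 <;> nlinarith

theorem sub_le_gapEnd {k : ℕ} (hk : k < I.n) : I.x (k + 1) - I.r ≤ I.gapEnd k := by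
  have := I.r_pos
  rw [gapEnd_of_lt I hk]
  split_ifs with h <;> linarith

/-- Leaving out sensors `b, …, n` only, the gap before sensor `b` extends beyond what `b - 1`
attached sensors can cover. -/
theorem le_lastMoved_of_neg {b : ℕ} (hb : 1 ≤ b) (hn : b ≤ I.n) (h : I.balance b < 0) :
    b ≤ I.lastMoved := by
  obtain ⟨k, rfl⟩ : ∃ k, b = k + 1 := ⟨b - 1, by omega⟩
  by_contra h1
  have h2 := I.gapEnd_le_of_lastMoved_le (k := k) (by omega) (by omega)
  have h3 := I.sub_le_gapEnd (k := k) (by omega)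
  rw [balance_eq, rightTurn_eq] at h
  push_cast at h
  linarith

theorem covered_iff : I.Covered I.x ↔ I.lastMoved = 0 := by
  constructor
  · intro h
    refine Nat.le_zero.1 (I.lastMoved_le (Nat.zero_le _)
      ((I.uncoveredAfter_le_iff (Nat.zero_le _)).1 ?_))
    intro p hp
    obtain ⟨i, hi, h1⟩ := h p hp.1
    exact absurd h1 (hp.2 i ⟨by have := hi.1; omega, hi.2⟩)
  · intro h p hp
    have h1 := I.lastMoved_spec.2
    rw [h] at h1
    push_cast at h1
    by_contra! h2
    obtain ⟨h3, h4⟩ := I.le_gapEnd_of_mem (Nat.zero_le _) p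
      ⟨hp, fun i hi => h2 i ⟨by have := hi.1; omega, hi.2⟩⟩
    have := I.L_pos
    have := hp.1
    rcases h4 with h4 | h4 <;> linarith

/-! ### The rightmost point of the trajectory -/

theorem x_sub_le_gapEnd {k : ℕ} (hk : 1 ≤ k) (hn : k ≤ I.n) : I.x k - I.r ≤ I.gapEnd k := by
  rcases eq_or_lt_of_le hn with h | h
  · rw [h, gapEnd_n]
    linarith [I.x_le_L I.one_le_n le_rfl, I.r_pos]
  · linarith [I.sub_le_gapEnd h, I.x_le hk (Nat.le_succ k) h]

/-- By minimality the test fails at `lastMoved - 1`. Either sensor `lastMoved` does not reach the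
last gap, or its left end is beyond the first `lastMoved - 1` attached ranges, which makes its
balance negative. -/
theorem gapEnd_lastMoved_gt (hk : 1 ≤ I.lastMoved) :
    2 * I.r * (I.lastMoved - 1) < I.gapEnd I.lastMoved ∧
      (0 ≤ I.balance I.lastMoved → I.x I.lastMoved + I.r < I.gapEnd I.lastMoved) := by
  obtain ⟨k, hk'⟩ : ∃ k, I.lastMoved = k + 1 := ⟨I.lastMoved - 1, by omega⟩
  have hn := I.lastMoved_le_n
  have h1 : 2 * I.r * k < I.gapEnd k := by
    by_contra! h
    have := I.lastMoved_le (by omega) h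
    omega
  have hr := I.r_pos
  rw [gapEnd_of_lt I (by omega)] at h1
  rw [hk', balance_eq, rightTurn_eq]
  push_cast
  split_ifs at h1 with h2
  · exact ⟨by linarith, fun _ => h2⟩
  · have h3 := I.x_sub_le_gapEnd (k := k + 1) (by omega) (by omega)
    exact ⟨by linarith, fun h => by linarith⟩

theorem gapEnd_lastMoved_pos (hk : 1 ≤ I.lastMoved) : 0 < I.gapEnd I.lastMoved := by
  refine lt_of_le_of_lt ?_ (I.gapEnd_lastMoved_gt hk).1
  have h1 : (1 : ℝ) ≤ I.lastMoved := by exact_mod_cast hk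
  have := I.r_pos
  exact mul_nonneg (by linarith) (by linarith)

theorem farPoint_of_neg (h : I.balance I.lastMoved < 0) : I.farPoint = I.x I.lastMoved := by
  simp [farPoint, h]

theorem farPoint_of_nonneg (hk : 1 ≤ I.lastMoved) (h : 0 ≤ I.balance I.lastMoved) :
    I.farPoint = I.gapEnd I.lastMoved - I.r := by
  simp [farPoint, not_lt.2 h, I.sSup_uncoveredAfter I.lastMoved_le_n (I.gapEnd_lastMoved_pos hk)]

theorem x_lt_farPoint_of_nonneg (hk : 1 ≤ I.lastMoved) (h : 0 ≤ I.balance I.lastMoved) :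
    I.x I.lastMoved < I.farPoint := by
  have := (I.gapEnd_lastMoved_gt hk).2 h
  rw [I.farPoint_of_nonneg hk h]; linarith

theorem x_lastMoved_le_farPoint (hk : 1 ≤ I.lastMoved) : I.x I.lastMoved ≤ I.farPoint := by
  by_cases h : I.balance I.lastMoved < 0
  · exact (I.farPoint_of_neg h).ge
  · exact (I.x_lt_farPoint_of_nonneg hk (not_lt.1 h)).le

theorem gapEnd_le_farPoint_add (hk : 1 ≤ I.lastMoved) :
    I.gapEnd I.lastMoved ≤ I.farPoint + I.r := by
  by_cases h : I.balance I.lastMoved < 0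
  · rw [I.farPoint_of_neg h]
    rw [balance_eq, rightTurn_eq] at h
    linarith [I.lastMoved_spec.2]
  · rw [I.farPoint_of_nonneg hk (not_lt.1 h)]; linarith

theorem farPoint_le_L (hk : 1 ≤ I.lastMoved) : I.farPoint ≤ I.L := by
  by_cases h : I.balance I.lastMoved < 0
  · rw [I.farPoint_of_neg h]
    exact I.x_le_L hk I.lastMoved_le_n
  · rw [I.farPoint_of_nonneg hk (not_lt.1 h)]
    linarith [I.gapEnd_le_L I.lastMoved_le_n, I.r_pos]

theorem farPoint_pos (hk : 1 ≤ I.lastMoved) : 0 < I.farPoint := by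
  by_cases h : I.balance I.lastMoved < 0
  · rw [I.farPoint_of_neg h]
    rw [balance_eq] at h
    linarith [I.rightTurn_pos hk]
  · exact (I.x_nonneg hk I.lastMoved_le_n).trans_lt (I.x_lt_farPoint_of_nonneg hk (not_lt.1 h))

theorem x_le_farPoint {i : ℕ} (hi : 1 ≤ i) (hk : i ≤ I.lastMoved) : I.x i ≤ I.farPoint :=
  (I.x_le hi hk I.lastMoved_le_n).trans (I.x_lastMoved_le_farPoint (hi.trans hk))

/-! ### The structure of the delimiters -/

/-- This is where the total range enters: the last sensor cannot be too far to the right, so every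
block of negative balances is closed by a left turn. -/
theorem balance_n_gt : -2 * I.r < I.balance I.n := by
  rw [balance_eq, rightTurn_eq]
  have := I.enough
  have := I.x_le_L I.one_le_n le_rfl
  have := I.r_pos
  linarith

theorem neg_of_isLeftTurn {a : ℕ} (h : I.IsLeftTurn a) : I.balance a < 0 := by
  have := I.r_pos
  rcases h with h | h
  · exact h.2
  · rw [h.1]; linarith

/-- From one sensor to the next the balance grows by at most `2r`. Starting from at most `-2r` it
can become nonnegative only if it is exactly `-2r` and the two sensors coincide, which is the
exceptional clause of `IsLeftTurn`. -/
theorem neg_step {i : ℕ} (h1 : 1 ≤ i) (hn : i ≤ I.n) (h : I.balance i < 0)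
    (hl : ¬ I.IsLeftTurn i) : I.balance i ≤ -2 * I.r ∧ i < I.n ∧ I.balance (i + 1) < 0 := by
  have hd : I.balance i ≤ -2 * I.r := by
    by_contra! h2
    exact hl (Or.inl ⟨h2, h⟩)
  have hlt : i < I.n := by
    refine lt_of_le_of_ne hn ?_
    rintro rfl
    linarith [I.balance_n_gt]
  refine ⟨hd, hlt, ?_⟩
  by_contra! h2
  have hx := I.x_le h1 (Nat.le_succ i) hlt
  rw [balance_eq, rightTurn_succ] at h2
  rw [balance_eq] at hd
  refine hl (Or.inr ⟨?_, hlt, ?_⟩)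
  · rw [balance_eq]; linarith
  · linarith

/-- `I.Delimits p D`: the list `D` consists of pairs `(b, a)` that cut the sensors
`p + 1, …, n` into blocks `b, …, a` of negative balance, separated by blocks
of nonnegative balance. -/
inductive Delimits (I : Barrier) : ℕ → List (ℕ × ℕ) → Prop
  | nil {p : ℕ} : (∀ i, p < i → i ≤ I.n → 0 ≤ I.balance i) → Delimits I p []
  | cons {p b a : ℕ} {D : List (ℕ × ℕ)} : p < b → b ≤ a → a ≤ I.n →
      (∀ i, p < i → i < b → 0 ≤ I.balance i) →
      (∀ i, b ≤ i → i ≤ a → I.balance i < 0) →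
      (∀ i, b ≤ i → i < a → I.balance i ≤ -2 * I.r) →
      (∀ i, a < i → i ≤ I.n → I.balance i < 0 → I.x a < I.rightTurn i) →
      Delimits I a D → Delimits I p ((b, a) :: D)

open Classical in
/-- One pass over the indices in the list that finds the delimiters. The argument `b` is the
first index of negative balance since the last left-turning point, and `0` if there is none. -/
def scan (I : Barrier) : ℕ → List ℕ → List (ℕ × ℕ)
  | _, [] => []
  | b, i :: is =>
    if I.IsLeftTurn i then (if b = 0 then i else b, i) :: I.scan 0 is
    else I.scan (if b = 0 ∧ I.balance i < 0 then i else b) is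

/-- Keeps consecutive triples disjoint. In the exceptional case `x a` equals the attached position
of sensor `a + 1`, but that sensor then has balance `0`, so the next negative one comes later. -/
theorem x_lt_rightTurn_of_isLeftTurn {a i : ℕ} (ha : I.IsLeftTurn a) (hi : a < i)
    (h : I.balance i < 0) : I.x a < I.rightTurn i := by
  have h1 := I.rightTurn_mono hi
  rw [Nat.succ_eq_add_one, rightTurn_succ] at h1
  rcases ha with ha | ha
  · have := ha.1
    rw [balance_eq] at this
    linarith
  · have h2 := ha.1
    rw [balance_eq] at h2
    rcases eq_or_lt_of_le (Nat.succ_le_of_lt hi) with h3 | h3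
    · subst h3
      rw [balance_eq, Nat.succ_eq_add_one, rightTurn_succ, ← ha.2.2] at h
      linarith
    · have h4 := I.rightTurn_mono h3
      rw [Nat.succ_eq_add_one, rightTurn_succ, rightTurn_succ] at h4
      linarith [I.r_pos]

-- Both claims share one invariant. Before index `i`, either no negative balance has been seen since
-- the last left turn `p`, or `b` is the first one, all sensors from `b` to `i - 1` have balance at
-- most `-2r`, and sensor `i` is again negative by `neg_step`.
open Classical in
theorem pairUp_eq_scan (len : ℕ) : ∀ p b i : ℕ, p < i → i + len = I.n + 1 →
    ((b = 0 ∧ ∀ j, p < j → j < i → 0 ≤ I.balance j) ∨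
      (p < b ∧ b < i ∧ i ≤ I.n ∧ (∀ j, p < j → j < b → 0 ≤ I.balance j) ∧ I.balance b < 0 ∧
        (∀ j, b ≤ j → j < i → I.balance j ≤ -2 * I.r) ∧ I.balance i < 0)) →
    I.pairUp p ((List.range' i len).filter (fun a => decide (I.IsLeftTurn a))) =
      I.scan b (List.range' i len) ∧ I.Delimits p (I.scan b (List.range' i len)) := by
  induction len with
  | zero =>
    intro p b i hp hi h
    simp only [List.range'_zero, List.filter_nil, pairUp, scan, true_and]
    rcases h with h | h
    · exact .nil fun j h1 h2 => h.2 j h1 (by omega)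
    · omega
  | succ len ih =>
    intro p b i hp hi h
    rw [List.range'_succ]
    have hr := I.r_pos
    by_cases hl : I.IsLeftTurn i
    · have hneg := I.neg_of_isLeftTurn hl
      obtain ⟨h1, h2⟩ := ih i 0 (i + 1) (by omega) (by omega)
        (Or.inl ⟨rfl, fun j h1 h2 => by omega⟩)
      set b' := if b = 0 then i else b with hb'
      have hb : p < b' ∧ b' ≤ i ∧ (∀ j, p < j → j < b' → 0 ≤ I.balance j) ∧
          (∀ j, b' ≤ j → j ≤ i → I.balance j < 0) ∧
          (∀ j, b' ≤ j → j < i → I.balance j ≤ -2 * I.r) := by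
        rcases h with ⟨rfl, h⟩ | ⟨h3, h4, h5, h6, h7, h8, h9⟩
        · rw [if_pos rfl] at hb'
          rw [hb']
          refine ⟨hp, le_rfl, h, fun j h3 h4 => ?_, fun j h3 h4 => by omega⟩
          rwa [show j = i by omega]
        · rw [if_neg (by omega)] at hb'
          rw [hb']
          refine ⟨h3, h4.le, h6, fun j h10 h11 => ?_, h8⟩
          rcases eq_or_lt_of_le h11 with h12 | h12
          · rwa [h12]
          · linarith [h8 j h10 h12]
      obtain ⟨hb1, hb2, hb3, hb4, hb5⟩ := hb
      have hs : I.scan b (i :: List.range' (i + 1) len) =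
          (b', i) :: I.scan 0 (List.range' (i + 1) len) := by
        rw [scan, if_pos hl]
      rw [hs, List.filter_cons, if_pos (by simpa using hl), pairUp, h1]
      refine ⟨?_, .cons hb1 hb2 (by omega) hb3 hb4 hb5
        (fun j h1 _ h3 => I.x_lt_rightTurn_of_isLeftTurn hl h1 h3) h2⟩
      congr 2
      refine le_antisymm (Nat.sInf_le ⟨hb1, by omega, hb4 _ le_rfl hb2⟩) ?_
      refine le_csInf ⟨b', hb1, by omega, hb4 _ le_rfl hb2⟩ ?_
      rintro j ⟨h3, h4, h5⟩
      by_contra! h6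
      linarith [hb3 j h3 h6]
    · have hs : I.scan b (i :: List.range' (i + 1) len) =
          I.scan (if b = 0 ∧ I.balance i < 0 then i else b) (List.range' (i + 1) len) := by
        rw [scan, if_neg hl]
      rw [hs, List.filter_cons, if_neg (by simpa using hl)]
      refine ih _ _ _ (by omega) (by omega) ?_
      by_cases hneg : I.balance i < 0
      · obtain ⟨hs1, hs2, hs3⟩ := I.neg_step (by omega) (by omega) hneg hl
        right
        rcases h with ⟨rfl, h⟩ | ⟨h3, h4, h5, h6, h7, h8, h9⟩
        · rw [if_pos ⟨rfl, hneg⟩]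
          refine ⟨hp, by omega, by omega, h, hneg, fun j h3 h4 => ?_, hs3⟩
          rwa [show j = i by omega]
        · rw [if_neg (by omega)]
          refine ⟨h3, by omega, by omega, h6, h7, fun j h10 h11 => ?_, hs3⟩
          rcases eq_or_lt_of_le (Nat.lt_succ_iff.1 h11) with h12 | h12
          · rwa [h12]
          · exact h8 j h10 h12
      · left
        rcases h with ⟨rfl, h⟩ | ⟨h3, h4, h5, h6, h7, h8, h9⟩
        · rw [if_neg (fun h => hneg h.2)]
          refine ⟨rfl, fun j h3 h4 => ?_⟩
          rcases eq_or_lt_of_le (Nat.lt_succ_iff.1 h4) with h5 | h5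
          · rw [h5]; exact not_lt.1 hneg
          · exact h j h3 h5
        · exact absurd h9 hneg

theorem delimiters_eq_scan : I.delimiters = I.scan 0 (List.range' 1 I.n) :=
  (I.pairUp_eq_scan I.n 0 0 1 (by omega) (by omega) (Or.inl ⟨rfl, by omega⟩)).1

theorem delimits_delimiters : I.Delimits 0 I.delimiters := by
  rw [delimiters_eq_scan]
  exact (I.pairUp_eq_scan I.n 0 0 1 (by omega) (by omega) (Or.inl ⟨rfl, by omega⟩)).2

/-! ### Trajectories by recursion over the delimiters -/

/-- The trajectory with triples at the first `j` pairs of a list of delimiters. -/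
def path : List (ℕ × ℕ) → ℕ → List ℝ
  | [], _ => [I.farPoint]
  | d :: _, 0 => [I.farPoint, I.rightTurn d.1]
  | d :: D, j + 1 => I.x d.2 :: I.rightTurn d.1 :: path D j

/-- The breakpoints of `path`. -/
def breaks : List (ℕ × ℕ) → ℕ → List ℝ
  | [], _ => [I.farPoint]
  | d :: _, 0 => [I.rightTurn d.1, I.farPoint]
  | d :: D, j + 1 => I.rightTurn d.1 :: I.x d.2 :: breaks D j

/-- The overhead of `path`. -/
def excess : List (ℕ × ℕ) → ℕ → ℝ
  | [], _ => 0
  | d :: _, 0 => I.farPoint - I.rightTurn d.1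
  | d :: D, j + 1 => 2 * (I.x d.2 - I.rightTurn d.1) + excess D j

theorem trajectory_eq (j : ℕ) : I.trajectory j = I.path I.delimiters j := by
  rw [trajectory]
  generalize I.delimiters = D
  induction D generalizing j with
  | nil => simp [path]
  | cons d D ih => cases j with
    | zero => simp [path]
    | succ j => simp [path, ← ih]

theorem breakpoints_eq (j : ℕ) : I.breakpoints j = I.breaks I.delimiters j := by
  rw [breakpoints]
  generalize I.delimiters = D
  induction D generalizing j with
  | nil => simp [breaks]
  | cons d D ih => cases j with
    | zero => simp [breaks]
    | succ j => simp [breaks, ← ih]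

theorem overhead_eq (j : ℕ) : I.overhead j = I.excess I.delimiters j := by
  rw [overhead]
  generalize I.delimiters = D
  induction D generalizing j with
  | nil => simp [excess]
  | cons d D ih => cases j with
    | zero => simp [excess]
    | succ j => simp [excess, ← ih]; ring

theorem bestIndex_spec : I.bestIndex ≤ I.delimiters.length ∧
    ∀ i ≤ I.delimiters.length, I.overhead I.bestIndex ≤ I.overhead i := by
  obtain ⟨j, hj, h⟩ := Finset.exists_min_image (Finset.range (I.delimiters.length + 1))
    I.overhead ⟨0, by simp⟩
  simp only [Finset.mem_range, Nat.lt_succ_iff] at hj h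
  exact Nat.sInf_mem (s := {j : ℕ | j ≤ I.delimiters.length ∧
    ∀ i ≤ I.delimiters.length, I.overhead j ≤ I.overhead i}) ⟨j, hj, h⟩

/-! ### The shape of the trajectories -/

/-- The last hypothesis keeps triples away from `c`: either a double follows, whose left end
separates them from `c`, or all sensors of negative balance start strictly before `c`. -/
theorem breaks_pairwise {p : ℕ} {D : List (ℕ × ℕ)} (hD : I.Delimits p D) :
    ∀ (j : ℕ) (s : ℝ), (∀ i, p < i → i ≤ I.n → I.balance i < 0 → s < I.rightTurn i) →
      (D.length ≤ j → s < I.farPoint) →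
      (j < D.length ∨ ∀ i, p < i → i ≤ I.n → I.balance i < 0 → I.x i < I.farPoint) →
      (s :: I.breaks D j).IsChain (· < ·) := by
  induction hD with
  | nil h =>
    intro j s hs hc hj
    simpa [breaks] using hc (by simp)
  | @cons p b a D hpb hba han hpos hneg hdeep hnext hD ih =>
    intro j s hs hc hj
    have hb := hs b hpb (hba.trans han) (hneg b le_rfl hba)
    have hxb : I.rightTurn b < I.x b := by
      have := hneg b le_rfl hba
      rw [balance_eq] at this; linarith
    cases j with
    | zero =>
      have h1 := I.x_le_farPoint (i := b) (by omega)
        (I.le_lastMoved_of_neg (by omega) (hba.trans han) (hneg b le_rfl hba))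
      simp only [breaks, List.isChain_cons_cons, List.isChain_singleton, and_true]
      exact ⟨hb, by linarith⟩
    | succ j =>
      simp only [breaks]
      rw [List.isChain_cons_cons, List.isChain_cons_cons]
      refine ⟨hb, hxb.trans_le (I.x_le (by omega) hba han), ih j (I.x a) hnext ?_ ?_⟩
      · intro h
        rcases hj with hj | hj
        · simp at hj; omega
        · exact hj a (by omega) han (hneg a hba le_rfl)
      · rcases hj with hj | hj
        · left; simpa using hj
        · right; intro i hi; exact hj i (by omega)

/-- A triple whose right end is at or beyond `c` walks its segment twice extra, while a double from
`c` back to the same left end walks it only once extra. Hence the choice without a double is not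
optimal here. -/
theorem excess_lt_of_neg {p k : ℕ} {D : List (ℕ × ℕ)} (hD : I.Delimits p D)
    (hk : p < k) (hkn : k ≤ I.n) (hneg : I.balance k < 0) (hx : I.farPoint ≤ I.x k)
    (hle : ∀ i, 1 ≤ i → i ≤ I.n → I.balance i < 0 → i ≤ k) :
    ∃ j < D.length, I.excess D j < I.excess D D.length := by
  induction hD with
  | nil h => linarith [h k hk hkn]
  | @cons p b a D hpb hba han hpos hneg' hdeep hnext hD ih =>
    by_cases hka : k ≤ a
    · have hDnil : D = [] := by
        cases hD with
        | nil => rfl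
        | @cons _ b' a' D' h1 h2 h3 h4 h5 =>
          have := hle b' (by omega) (by omega) (h5 b' le_rfl h2)
          omega
      subst hDnil
      refine ⟨0, by simp, ?_⟩
      have h1 := I.x_le (by omega) hka han
      have h2 := hneg' b le_rfl hba
      have h3 := I.x_le_farPoint (i := b) (by omega)
        (I.le_lastMoved_of_neg (by omega) (hba.trans han) (hneg' b le_rfl hba))
      rw [balance_eq] at h2
      simp only [excess, List.length_singleton]
      linarith
    · obtain ⟨j, hj, h⟩ := ih (by omega)
      exact ⟨j + 1, by simpa using hj, by simpa [excess] using h⟩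

theorem farPoint_mem_breaks (D : List (ℕ × ℕ)) (j : ℕ) : I.farPoint ∈ I.breaks D j := by
  induction D generalizing j with
  | nil => simp [breaks]
  | cons d D ih => cases j <;> simp [breaks, ih]

theorem path_mem (D : List (ℕ × ℕ)) : ∀ (j : ℕ) (s : ℝ),
    (s :: I.breaks D j).Pairwise (· < ·) → ∀ t ∈ I.path D j, s < t ∧ t ≤ I.farPoint := by
  induction D with
  | nil => intro j s h; simpa [breaks, path] using h
  | cons d D ih =>
    intro j s h
    cases j with
    | zero =>
      simp [breaks, path] at h ⊢
      refine ⟨h.1.2, h.1.1, h.2.le⟩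
    | succ j =>
      simp only [breaks] at h
      rw [List.pairwise_cons, List.pairwise_cons] at h
      obtain ⟨h1, h2, h3⟩ := h
      rw [List.pairwise_cons] at h3
      simp only [List.mem_cons, forall_eq_or_imp] at h1 h2
      have hc := I.farPoint_mem_breaks D j
      have h5 : (s :: I.breaks D j).Pairwise (· < ·) := List.pairwise_cons.2 ⟨h1.2.2, h3.2⟩
      simp only [path, List.mem_cons, forall_eq_or_imp]
      exact ⟨⟨h1.2.1, (h3.1 _ hc).le⟩, ⟨h1.1, (h2.2 _ hc).le⟩, ih j s h5⟩

theorem path_alternating (D : List (ℕ × ℕ)) : ∀ (j : ℕ) (s : ℝ),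
    (s :: I.breaks D j).Pairwise (· < ·) → Alternating true s (I.path D j) ∧
      pathLength s (I.path D j) = I.farPoint - s + I.excess D j := by
  induction D with
  | nil =>
    intro j s h
    simp [breaks, path, Alternating, pathLength, excess] at h ⊢
    exact ⟨h, h.le⟩
  | cons d D ih =>
    intro j s h
    cases j with
    | zero =>
      simp [breaks, path, Alternating, pathLength, excess] at h ⊢
      refine ⟨⟨h.1.2, h.2⟩, ?_⟩
      rw [abs_of_pos (by linarith), abs_of_neg (by linarith)]; ring
    | succ j =>
      simp only [breaks] at h
      rw [List.pairwise_cons, List.pairwise_cons] at h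
      obtain ⟨h1, h2, h3⟩ := h
      rw [List.pairwise_cons] at h3
      simp only [List.mem_cons, forall_eq_or_imp] at h1 h2
      obtain ⟨h4, h5⟩ := ih j (I.rightTurn d.1) (List.pairwise_cons.2 ⟨h2.2, h3.2⟩)
      simp only [path, Alternating, pathLength, excess]
      refine ⟨⟨h1.2.1, h2.1, h4⟩, ?_⟩
      rw [h5, abs_of_pos (by linarith), abs_of_neg (by linarith)]; ring

theorem breaks_bestIndex_pairwise (hk : 1 ≤ I.lastMoved) :
    (0 :: I.breaks I.delimiters I.bestIndex).Pairwise (· < ·) := by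
  rw [← List.isChain_iff_pairwise]
  refine I.breaks_pairwise I.delimits_delimiters _ _
    (fun i h _ _ => I.rightTurn_pos h) (fun _ => I.farPoint_pos hk) ?_
  by_cases h : I.balance I.lastMoved < 0
  · left
    obtain ⟨j, hj, h1⟩ := I.excess_lt_of_neg I.delimits_delimiters (k := I.lastMoved) (by omega)
      I.lastMoved_le_n h (I.farPoint_of_neg h).le (fun i => I.le_lastMoved_of_neg)
    obtain ⟨h2, h3⟩ := I.bestIndex_spec
    refine lt_of_le_of_ne h2 fun h4 => ?_
    have := h3 j hj.le
    rw [overhead_eq, overhead_eq, h4] at this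
    linarith
  · right
    intro i h1 h2 h3
    exact (I.x_le h1 (I.le_lastMoved_of_neg h1 h2 h3) I.lastMoved_le_n).trans_lt
      (I.x_lt_farPoint_of_nonneg hk (not_lt.1 h))

end Barrier

end BarrierRobot

end

/-! ### Upper bound: following the trajectories restores coverage -/

noncomputable section

namespace BarrierRobot

open Set

/-! ### What the robot can do on one sweep -/

/-- `E` collects the points where something is picked up or dropped. The robot halts at each in
increasing order and takes along exactly the sensors at its current point that are not yet at their
targets. -/
theorem sweep_of_events (E : Finset ℝ) : ∀ (s t : ℝ) (w z : ℕ → ℝ), s ≤ t →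
    (∀ q ∈ E, s < q ∧ q ≤ t) →
    (∀ i, w i ≠ z i → s ≤ w i ∧ w i ≤ z i ∧ (w i = s ∨ w i ∈ E) ∧ z i ∈ E) →
    Sweep t ⟨s, w⟩ ⟨t, z⟩ := by
  induction E using Finset.induction_on_min with
  | empty =>
    intro s t w z hst _ h
    have hwz : w = z := by
      funext i
      by_contra hi
      simpa using (h i hi).2.2.2
    subst hwz
    refine .leg _ _ t ∅ right_mem_uIcc (by simp) ?_
    have h1 : (Config.carry ⟨s, w⟩ t ∅) = ⟨t, w⟩ := by simp [Config.carry]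
    rw [h1]
    exact .done _ rfl
  | insert a E ha ih =>
    intro s t w z hst hE h
    obtain ⟨hsa, hat⟩ := hE a (Finset.mem_insert_self _ _)
    refine .leg _ _ a {i | w i ≠ z i ∧ w i = s} ?_ (fun i hi => hi.2) ?_
    · rw [uIcc_of_le hst]
      exact ⟨hsa.le, hat⟩
    · refine ih a t _ z hat (fun q hq => ⟨ha q hq, (hE q (Finset.mem_insert_of_mem hq)).2⟩) ?_
      intro i hi
      by_cases hS : w i ≠ z i ∧ w i = s
      · have hm : i ∈ {i | w i ≠ z i ∧ w i = s} := hS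
        simp only [if_pos hm] at hi ⊢
        have h1 := (h i hS.1).2.2.2
        rcases Finset.mem_insert.1 h1 with h2 | h2
        · exact absurd h2.symm hi
        · exact ⟨le_rfl, (ha _ h2).le, by simp, h2⟩
      · have hm : i ∉ {i | w i ≠ z i ∧ w i = s} := hS
        simp only [if_neg hm] at hi ⊢
        obtain ⟨h1, h2, h3, h4⟩ := h i hi
        have h5 : w i ≠ s := fun h5 => hS ⟨hi, h5⟩
        have h6 := h3.resolve_left h5
        have h7 : a ≤ w i := by
          rcases Finset.mem_insert.1 h6 with h8 | h8
          · exact h8.ge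
          · exact (ha _ h8).le
        refine ⟨h7, h2, Finset.mem_insert.1 h6, ?_⟩
        rcases Finset.mem_insert.1 h4 with h8 | h8
        · exact absurd (le_antisymm h2 (h8 ▸ h7)) hi
        · exact h8

/-- On a sweep to the right, the robot can move any sensors on its way to the right. -/
theorem sweep_right {n : ℕ} {s t : ℝ} {w z : ℕ → ℝ} (hst : s ≤ t)
    (h : ∀ i, w i ≠ z i → i ≤ n ∧ s ≤ w i ∧ w i ≤ z i ∧ z i ≤ t) :
    Sweep t ⟨s, w⟩ ⟨t, z⟩ := by
  refine sweep_of_events (((Finset.range (n + 1)).image w ∪ (Finset.range (n + 1)).image z).filter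
    (fun q => s < q ∧ q ≤ t)) s t w z hst (fun q hq => (Finset.mem_filter.1 hq).2) ?_
  intro i hi
  obtain ⟨h1, h2, h3, h4⟩ := h i hi
  have h5 := lt_of_le_of_ne h3 hi
  refine ⟨h2, h3, ?_, ?_⟩
  · rcases eq_or_lt_of_le h2 with h6 | h6
    · exact Or.inl h6.symm
    · right
      rw [Finset.mem_filter, Finset.mem_union]
      exact ⟨Or.inl (Finset.mem_image_of_mem _ (by simp; omega)), h6, by linarith⟩
  · rw [Finset.mem_filter, Finset.mem_union]
    exact ⟨Or.inr (Finset.mem_image_of_mem _ (by simp; omega)), by linarith, h4⟩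

/-- Mirror image of a configuration. -/
def Config.neg (c : Config) : Config := ⟨-c.pos, fun i => -c.loc i⟩

theorem Sweep.neg {t : ℝ} {c c' : Config} (h : Sweep t c c') : Sweep (-t) c.neg c'.neg := by
  induction h with
  | done c hc => exact .done _ (by simp [Config.neg, hc])
  | leg c c' q S hq hS _ ih =>
    refine .leg _ _ (-q) S ?_ (fun i hi => ?_) ?_
    · rw [Config.neg, mem_uIcc] at *
      rcases hq with hq | hq
      · right; constructor <;> linarith [hq.1, hq.2]
      · left; constructor <;> linarith [hq.1, hq.2]
    · simp [Config.neg, hS i hi]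
    · have h1 : (c.carry q S).neg = c.neg.carry (-q) S := by
        simp only [Config.neg, Config.carry, Config.mk.injEq, true_and]
        funext i
        split_ifs <;> rfl
      rwa [← h1]

theorem sweep_left {n : ℕ} {s t : ℝ} {w z : ℕ → ℝ} (hts : t ≤ s)
    (h : ∀ i, w i ≠ z i → i ≤ n ∧ t ≤ z i ∧ z i ≤ w i ∧ w i ≤ s) :
    Sweep t ⟨s, w⟩ ⟨t, z⟩ := by
  have h1 : Sweep (-t) ⟨-s, fun i => -w i⟩ ⟨-t, fun i => -z i⟩ := by
    refine sweep_right (n := n) (by linarith) fun i hi => ?_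
    obtain ⟨h1, h2, h3, h4⟩ := h i (fun h => hi (by simp [h]))
    exact ⟨h1, by linarith, by linarith, by linarith⟩
  simpa [Config.neg] using h1.neg

/-- All moves to the right are made on the way to `t`, and all moves to the left on the way back to
`u`. -/
theorem sweep_double {n : ℕ} {s t u : ℝ} {w z : ℕ → ℝ} (hst : s ≤ t) (hut : u ≤ t)
    (h : ∀ i, w i = z i ∨ i ≤ n ∧ (s ≤ w i ∧ w i ≤ z i ∧ z i ≤ t ∨
      u ≤ z i ∧ z i ≤ w i ∧ w i ≤ t)) :
    ∃ c, Sweep t ⟨s, w⟩ c ∧ Sweep u c ⟨u, z⟩ := by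
  classical
  refine ⟨⟨t, fun i => if s ≤ w i ∧ w i ≤ z i ∧ z i ≤ t then z i else w i⟩,
    sweep_right (n := n) hst fun i hi => ?_, sweep_left (n := n) hut fun i hi => ?_⟩
  · by_cases h1 : s ≤ w i ∧ w i ≤ z i ∧ z i ≤ t
    · rw [if_pos h1] at hi ⊢
      exact ⟨((h i).resolve_left hi).1, h1⟩
    · rw [if_neg h1] at hi
      exact absurd rfl hi
  · by_cases h1 : s ≤ w i ∧ w i ≤ z i ∧ z i ≤ t
    · rw [if_pos h1] at hi
      exact absurd rfl hi
    · rw [if_neg h1] at hi ⊢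
      obtain ⟨h2, h3⟩ := (h i).resolve_left hi
      exact ⟨h2, h3.resolve_left h1⟩

namespace Barrier

variable (I : Barrier)

/-! ### The final positions -/

/-- Sensors `1, …, p` are in attached positions, the others in their initial positions. -/
def attached (p i : ℕ) : ℝ := if 1 ≤ i ∧ i ≤ p then I.rightTurn i else I.x i

/-- The final positions of the sensors when the robot follows the output of the algorithm. -/
def final (i : ℕ) : ℝ :=
  if 1 ≤ i ∧ i ≤ I.n then
    if i ≤ I.lastMoved then min (I.rightTurn i) I.farPoint else max I.farPoint (I.x i)
  else I.x i

theorem final_of_le {i : ℕ} (h1 : 1 ≤ i) (h : i ≤ I.lastMoved) :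
    I.final i = min (I.rightTurn i) I.farPoint := by
  rw [final, if_pos ⟨h1, h.trans I.lastMoved_le_n⟩, if_pos h]

theorem final_of_gt {i : ℕ} (h : I.lastMoved < i) (hn : i ≤ I.n) :
    I.final i = max I.farPoint (I.x i) := by
  rw [final, if_pos ⟨by omega, hn⟩, if_neg (by omega)]

/-- Up to `gapEnd`, the attached ranges suffice, and those truncated at `c` still reach `c + r`,
which is not before the gap end. Beyond it, a sensor `i > lastMoved` that covered a point still does
so after being pulled up to `c`, since `c - r` is not beyond the gap end. -/
theorem final_covered (hk : 1 ≤ I.lastMoved) : I.Covered I.final := by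
  intro p hp
  have hr := I.r_pos
  by_cases hG : p ≤ I.gapEnd I.lastMoved
  · have h1 := hG.trans I.lastMoved_spec.2
    have h2 := hG.trans (I.gapEnd_le_farPoint_add hk)
    obtain ⟨i, hi, hik, hl, hu⟩ : ∃ i, 1 ≤ i ∧ i ≤ I.lastMoved ∧ I.rightTurn i - I.r ≤ p ∧
        p ≤ I.rightTurn i + I.r := by
      rcases eq_or_lt_of_le hp.1 with h0 | h0
      · refine ⟨1, le_rfl, hk, ?_, ?_⟩ <;> rw [rightTurn_eq, ← h0] <;> push_cast <;> linarith
      -- Attached sensor `i` covers the points from `2r(i - 1)` to `2ri`; the point `0` is treated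
      -- apart because its ceiling would be `0`.
      · refine ⟨⌈p / (2 * I.r)⌉₊, Nat.ceil_pos.2 (by positivity), ?_, ?_, ?_⟩
        · rw [Nat.ceil_le, div_le_iff₀ (by positivity)]
          linarith
        · have := (Nat.ceil_lt_add_one (show 0 ≤ p / (2 * I.r) by positivity)).le
          rw [← sub_le_iff_le_add, le_div_iff₀ (by positivity)] at this
          rw [rightTurn_eq]
          linarith
        · have := Nat.le_ceil (p / (2 * I.r))
          rw [div_le_iff₀ (by positivity)] at this
          rw [rightTurn_eq]
          linarith
    refine ⟨i, ⟨hi, hik.trans I.lastMoved_le_n⟩, ?_⟩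
    rw [I.final_of_le hi hik]
    rcases le_total (I.rightTurn i) I.farPoint with h3 | h3
    · rw [min_eq_left h3]; exact ⟨hl, hu⟩
    · rw [min_eq_right h3]; exact ⟨by linarith, h2⟩
  · have h1 : p ∉ I.uncoveredAfter I.lastMoved :=
      fun h => hG (I.le_gapEnd_of_mem I.lastMoved_le_n p h).1
    simp only [uncoveredAfter, mem_ofPred_eq, not_and, not_forall, not_not] at h1
    obtain ⟨i, hi, h2⟩ := h1 hp
    refine ⟨i, ⟨by have := hi.1; omega, hi.2⟩, ?_⟩
    rw [I.final_of_gt (by have := hi.1; omega) hi.2]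
    rcases le_total I.farPoint (I.x i) with h3 | h3
    · rwa [max_eq_right h3]
    · rw [max_eq_left h3]
      have h4 : I.farPoint - I.r ≤ I.gapEnd I.lastMoved := by
        by_cases hneg : I.balance I.lastMoved < 0
        · rw [I.farPoint_of_neg hneg]
          exact I.x_sub_le_gapEnd hk I.lastMoved_le_n
        · rw [I.farPoint_of_nonneg hk (not_lt.1 hneg)]; linarith
      exact ⟨by linarith, by linarith [h2.2]⟩

theorem final_monotone : I.OrderPreserving I.final := by
  intro i hi j hj hij
  by_cases h1 : j ≤ I.lastMoved
  · rw [I.final_of_le hi.1 (hij.trans h1), I.final_of_le hj.1 h1]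
    exact min_le_min_right _ (I.rightTurn_mono hij)
  · rw [I.final_of_gt (not_le.1 h1) hj.2]
    by_cases h2 : i ≤ I.lastMoved
    · rw [I.final_of_le hi.1 h2]
      exact (min_le_right _ _).trans (le_max_left _ _)
    · rw [I.final_of_gt (not_le.1 h2) hi.2]
      exact max_le_max_left _ (I.x_le hi.1 hij hj.2)

theorem final_eq_of_lt {i : ℕ} (hi : i ∈ Icc 1 I.n) (h : I.final i < I.farPoint) :
    I.final i = 2 * I.r * i - I.r := by
  by_cases h1 : i ≤ I.lastMoved
  · rw [I.final_of_le hi.1 h1] at h ⊢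
    rcases min_lt_iff.1 h with h2 | h2
    · rw [min_eq_left h2.le, rightTurn_eq]
    · exact absurd h2 (lt_irrefl _)
  · rw [I.final_of_gt (not_le.1 h1) hi.2] at h
    exact absurd h (not_lt.2 (le_max_left _ _))

/-! ### The robot reaches the final positions -/

theorem x_le_rightTurn {i : ℕ} (h : 0 ≤ I.balance i) : I.x i ≤ I.rightTurn i := by
  rw [balance_eq] at h; linarith

theorem rightTurn_lt_x {i : ℕ} (h : I.balance i < 0) : I.rightTurn i < I.x i := by
  rw [balance_eq] at h; linarith

/-- On arrival at a new pair, sensors `1, …, p` are attached and the others untouched. A triple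
attaches those up to `a`: sensors before `b` are dragged right, the block `b, …, a` is dragged left
on the way back. The last sweep or double does the rest. -/
theorem run_path {p : ℕ} {D : List (ℕ × ℕ)} (hD : I.Delimits p D) :
    ∀ (j : ℕ) (s : ℝ), p ≤ I.lastMoved → (∀ i, 1 ≤ i → i ≤ p → I.rightTurn i ≤ I.farPoint) →
      s ≤ I.farPoint → (∀ i, p < i → i ≤ I.n → s ≤ I.x i) →
      ∃ e, Run (I.path D j) ⟨s, I.attached p⟩ ⟨e, I.final⟩ := by
  have hkn := I.lastMoved_le_n
  -- In the final phase only sensors of negative balance need a move to the left, and their targets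
  -- are attached positions.
  have key : ∀ {p : ℕ} {s : ℝ}, p ≤ I.lastMoved →
      (∀ i, 1 ≤ i → i ≤ p → I.rightTurn i ≤ I.farPoint) →
      (∀ i, p < i → i ≤ I.n → s ≤ I.x i) →
      ∀ i, I.attached p i = I.final i ∨ i ≤ I.n ∧
        ((s ≤ I.attached p i ∧ I.attached p i ≤ I.final i ∧ I.final i ≤ I.farPoint) ∨
        (p < i ∧ I.balance i < 0 ∧ I.final i = I.rightTurn i ∧ I.attached p i = I.x i ∧
          I.x i ≤ I.farPoint)) := by
    intro p s hp hl hs i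
    by_cases hi : 1 ≤ i ∧ i ≤ I.n
    · by_cases hip : i ≤ p
      · left
        rw [attached, if_pos ⟨hi.1, hip⟩, I.final_of_le hi.1 (hip.trans hp),
          min_eq_left (hl i hi.1 hip)]
      · have hsx := hs i (not_le.1 hip) hi.2
        rw [attached, if_neg (fun h => hip h.2)]
        by_cases hik : i ≤ I.lastMoved
        · have hc := I.x_le_farPoint hi.1 hik
          rw [I.final_of_le hi.1 hik]
          right
          refine ⟨hi.2, ?_⟩
          by_cases hneg : I.balance i < 0
          · right
            have := I.rightTurn_lt_x hneg
            exact ⟨not_le.1 hip, hneg, min_eq_left (by linarith), rfl, hc⟩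
          · left
            exact ⟨hsx, le_min (I.x_le_rightTurn (not_lt.1 hneg)) hc, min_le_right _ _⟩
        · rw [I.final_of_gt (not_le.1 hik) hi.2]
          rcases le_total I.farPoint (I.x i) with h | h
          · left; rw [max_eq_right h]
          · right
            rw [max_eq_left h]
            exact ⟨hi.2, Or.inl ⟨hsx, h, le_rfl⟩⟩
    · left
      rw [attached, if_neg (by omega), final, if_neg hi]
  induction hD with
  | @nil p hnn =>
    intro j s hp hl hsc hs
    refine ⟨I.farPoint, .cons _ _ _ _ _ (sweep_right (n := I.n) hsc ?_) (.nil _)⟩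
    intro i hi
    obtain ⟨h1, h2⟩ := (key hp hl hs i).resolve_left hi
    rcases h2 with h2 | h2
    · exact ⟨h1, h2⟩
    · linarith [hnn i h2.1 h1, h2.2.1]
  | @cons p b a D hpb hba han hpos hneg hdeep hnext hD ih =>
    intro j s hp hl hsc hs
    have hb := I.rightTurn_lt_x (hneg b le_rfl hba)
    have ha := I.rightTurn_lt_x (hneg a hba le_rfl)
    have hxba := I.x_le (by omega) hba han
    have hak := I.le_lastMoved_of_neg (by omega) han (hneg a hba le_rfl)
    have hac := I.x_le_farPoint (by omega) hak
    have hlba := I.rightTurn_mono hba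
    cases j with
    | zero =>
      obtain ⟨c, h1, h2⟩ := sweep_double (n := I.n) (s := s) (t := I.farPoint)
        (u := I.rightTurn b) (w := I.attached p) (z := I.final) hsc (by linarith) (by
          intro i
          refine (key hp hl hs i).imp_right (And.imp_right (Or.imp_right ?_))
          rintro ⟨h1, h2, h3, h4, h5⟩
          -- No sensor between `p` and `b` has negative balance, so every target on the way back is
          -- at or after the end of the double.
          have hbi : b ≤ i := by
            by_contra! h
            linarith [hpos i h1 h]
          rw [h3, h4]
          exact ⟨I.rightTurn_mono hbi, (I.rightTurn_lt_x h2).le, h5⟩)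
      exact ⟨_, .cons _ _ _ _ _ h1 (.cons _ _ _ _ _ h2 (.nil _))⟩
    | succ j =>
      obtain ⟨c, h1, h2⟩ := sweep_double (n := I.n) (s := s) (t := I.x a)
        (u := I.rightTurn b) (w := I.attached p) (z := I.attached a)
        (hs a (by omega) han) (by linarith) (by
          intro i
          simp only [attached]
          by_cases hip : 1 ≤ i ∧ i ≤ p
          · left
            rw [if_pos hip, if_pos ⟨hip.1, by omega⟩]
          by_cases hia : 1 ≤ i ∧ i ≤ a
          · right
            refine ⟨by omega, ?_⟩
            rw [if_neg hip, if_pos hia]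
            by_cases hib : b ≤ i
            · right
              exact ⟨I.rightTurn_mono hib, (I.rightTurn_lt_x (hneg i hib hia.2)).le,
                I.x_le hia.1 hia.2 han⟩
            · left
              refine ⟨hs i (by omega) (by omega),
                I.x_le_rightTurn (hpos i (by omega) (by omega)), ?_⟩
              linarith [I.rightTurn_mono (not_le.1 hib).le]
          · left
            rw [if_neg hip, if_neg hia])
      obtain ⟨e, h3⟩ := ih j (I.rightTurn b) hak
        (fun i h3 h4 => by linarith [I.rightTurn_mono h4]) (by linarith)
        (fun i h3 h4 => by linarith [I.x_le (by omega) h3.le h4])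
      exact ⟨e, .cons _ _ _ _ _ h1 (.cons _ _ _ _ _ h2 h3)⟩

theorem produces_trajectory (hk : 1 ≤ I.lastMoved) (j : ℕ) :
    I.Produces (I.trajectory j) I.final := by
  obtain ⟨e, h⟩ := I.run_path I.delimits_delimiters j 0 (by omega) (fun i h1 h2 => by omega)
    (I.farPoint_pos hk).le (fun i h1 h2 => I.x_nonneg h1 h2)
  have h0 : I.attached 0 = I.x := by
    funext i
    rw [attached, if_neg (by omega)]
  rw [h0, ← trajectory_eq] at h
  exact ⟨_, h, rfl⟩

end Barrier

end BarrierRobot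

end

/-! ### Lower bound: points that must be crossed to the left -/

noncomputable section

namespace BarrierRobot

open Set MeasureTheory

/-! ### Points crossed from right to left -/

/-- On its way from `p` through the points of the list, the robot passes `q` from right to left. -/
def LeftCross (q : ℝ) : ℝ → List ℝ → Prop
  | _, [] => False
  | p, t :: ts => (t ≤ q ∧ q < p) ∨ LeftCross q t ts

/-- The total length of the movements to the left. -/
def leftLength : ℝ → List ℝ → ℝ
  | _, [] => 0
  | p, t :: ts => max (p - t) 0 + leftLength t ts

theorem leftLength_nonneg (p : ℝ) (ts : List ℝ) : 0 ≤ leftLength p ts := by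
  induction ts generalizing p with
  | nil => exact le_rfl
  | cons t ts ih => exact add_nonneg (le_max_right _ _) (ih t)

theorem pathLength_nonneg (p : ℝ) (ts : List ℝ) : 0 ≤ pathLength p ts := by
  induction ts generalizing p with
  | nil => exact le_rfl
  | cons t ts ih => exact add_nonneg (abs_nonneg _) (ih t)

/-- Movement to the right minus movement to the left is the net displacement. -/
theorem pathLength_eq (p : ℝ) (ts : List ℝ) :
    pathLength p ts = ts.getLastD p - p + 2 * leftLength p ts := by
  induction ts generalizing p with
  | nil => simp [pathLength, leftLength]
  | cons t ts ih =>
    rw [pathLength, leftLength, ih, List.getLastD_cons]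
    rcases le_total t p with h | h
    · rw [abs_of_nonpos (by linarith), max_eq_left (by linarith)]; ring
    · rw [abs_of_nonneg (by linarith), max_eq_right (by linarith)]; ring

theorem volume_leftCross_le (p : ℝ) (ts : List ℝ) :
    volume {q | LeftCross q p ts} ≤ ENNReal.ofReal (leftLength p ts) := by
  induction ts generalizing p with
  | nil => simp [LeftCross]
  | cons t ts ih =>
    have h : {q | LeftCross q p (t :: ts)} = Ico t p ∪ {q | LeftCross q t ts} := rfl
    rw [h, leftLength, ENNReal.ofReal_add (le_max_right _ _) (leftLength_nonneg _ _)]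
    refine (measure_union_le _ _).trans (add_le_add ?_ (ih t))
    rw [Real.volume_Ico]
    exact ENNReal.ofReal_le_ofReal (le_max_left _ _)

/-- A path that visits a point beyond `q` and ends at or before `q` crosses `q` to the left at its
last return. -/
theorem leftCross_of_last_le {q p : ℝ} {ts : List ℝ} (h : ∃ t ∈ p :: ts, q < t)
    (hl : ts.getLastD p ≤ q) : LeftCross q p ts := by
  induction ts generalizing p with
  | nil =>
    simp at h hl
    linarith
  | cons t ts ih =>
    rw [List.getLastD_cons] at hl
    by_cases h1 : ∃ u ∈ t :: ts, q < u
    · exact Or.inr (ih h1 hl)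
    · left
      push Not at h1
      obtain ⟨u, hu, hqu⟩ := h
      rcases List.mem_cons.1 hu with rfl | hu
      · exact ⟨h1 t (by simp), hqu⟩
      · linarith [h1 u hu]

/-! ### Invariants of the motion -/

theorem Sweep.pos_eq {t : ℝ} {c c' : Config} (h : Sweep t c c') : c'.pos = t := by
  induction h with
  | done c hc => exact hc
  | leg c c' q S hq hS _ ih => exact ih

/-- A sensor can pass `q` to the left only in the hands of a robot that passes `q` to the left. -/
theorem Sweep.gt_of_not_cross {q t : ℝ} {c c' : Config} (h : Sweep t c c')
    (hq : ¬ (t ≤ q ∧ q < c.pos)) {i : ℕ} (hi : q < c.loc i) : q < c'.loc i := by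
  induction h with
  | done c hc => exact hi
  | leg c c' u S hu hS _ ih =>
    rw [mem_uIcc] at hu
    have hcross : q < c.pos → q < u := by
      intro h
      have h1 : q < t := by
        by_contra! h1
        exact hq ⟨h1, h⟩
      rcases hu with hu | hu <;> linarith [hu.1]
    refine ih ?_ ?_
    · rintro ⟨h1, h2⟩
      simp only [Config.carry] at h2
      refine hq ⟨h1, ?_⟩
      by_contra! h3
      rcases hu with hu | hu <;> linarith [hu.1, hu.2]
    · simp only [Config.carry]
      split_ifs with h
      · exact hcross (by rwa [← hS i h])
      · exact hi

theorem Run.gt_of_not_leftCross {q : ℝ} {ts : List ℝ} {c c' : Config} (h : Run ts c c')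
    (hq : ¬ LeftCross q c.pos ts) {i : ℕ} (hi : q < c.loc i) : q < c'.loc i := by
  induction h with
  | nil c => exact hi
  | cons t ts c c' c'' hs _ ih =>
    simp only [LeftCross, not_or] at hq
    refine ih ?_ (hs.gt_of_not_cross hq.1 hi)
    rw [hs.pos_eq]
    exact hq.2

/-- A robot confined to the left of `M` neither picks up nor drops anything beyond `M`. -/
theorem Sweep.eq_or_le {M t : ℝ} {c c' : Config} (h : Sweep t c c') (hc : c.pos ≤ M)
    (ht : t ≤ M) (i : ℕ) : c'.loc i = c.loc i ∨ c.loc i ≤ M ∧ c'.loc i ≤ M := by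
  induction h with
  | done c hc => exact Or.inl rfl
  | leg c c' u S hu hS _ ih =>
    have hu' : u ≤ M := by
      rw [mem_uIcc] at hu
      rcases hu with hu | hu <;> linarith [hu.2]
    have h1 := ih hu'
    simp only [Config.carry] at h1
    split_ifs at h1 with h
    · right
      rw [hS i h]
      refine ⟨hc, ?_⟩
      rcases h1 with h1 | h1
      · rwa [h1]
      · exact h1.2
    · exact h1

theorem Run.eq_or_le {M : ℝ} {ts : List ℝ} {c c' : Config} (h : Run ts c c') (hc : c.pos ≤ M)
    (ht : ∀ t ∈ ts, t ≤ M) (i : ℕ) : c'.loc i = c.loc i ∨ c.loc i ≤ M ∧ c'.loc i ≤ M := by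
  induction h with
  | nil c => exact Or.inl rfl
  | cons t ts c c' c'' hs _ ih =>
    have ht' := ht t (by simp)
    have h1 := hs.eq_or_le hc ht' i
    have h2 := ih (by rwa [hs.pos_eq]) (fun u hu => ht u (by simp [hu]))
    rcases h1 with h1 | h1
    · rwa [h1] at h2
    · rcases h2 with h2 | h2
      · exact Or.inr ⟨h1.1, h2 ▸ h1.2⟩
      · exact Or.inr ⟨h1.1, h2.2⟩

namespace Barrier

variable (I : Barrier)

/-- If all but the first `s` sensors are to the right of `q`, then these reach beyond `q - r`. -/
theorem sub_lt_of_covered {y : ℕ → ℝ} (hy : I.Covered y) {s : ℕ} {q : ℝ}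
    (hL : q - I.r < I.L) (h : ∀ i, s < i → i ≤ I.n → q < y i) : q - I.r < 2 * I.r * s := by
  have hr := I.r_pos
  -- The conclusion is strict: finitely many strict inequalities leave room to replace `q` by a
  -- slightly larger `q'`.
  obtain ⟨q', hq', hL', h'⟩ : ∃ q', q < q' ∧ q' - I.r ≤ I.L ∧
      ∀ i, s < i → i ≤ I.n → q' < y i := by
    have h1 : ∀ᶠ q' in nhdsWithin q (Ioi q), ∀ i ∈ Finset.Ioc s I.n, q' < y i := by
      rw [Filter.eventually_all_finset]
      intro i hi
      rw [Finset.mem_Ioc] at hi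
      exact (eventually_lt_nhds (h i hi.1 hi.2)).filter_mono nhdsWithin_le_nhds
    have h2 : ∀ᶠ q' in nhdsWithin q (Ioi q), q' < I.L + I.r :=
      (eventually_lt_nhds (by linarith)).filter_mono nhdsWithin_le_nhds
    obtain ⟨q', h3, h4, h5⟩ := (h1.and (h2.and self_mem_nhdsWithin)).exists
    exact ⟨q', h5, by linarith, fun i hi hn => h3 i (Finset.mem_Ioc.2 ⟨hi, hn⟩)⟩
  -- Only the first `s` sensors can cover this interval, so its length is at most `2rs`.
  have hsub : Ico 0 (q' - I.r) ⊆ ⋃ i ∈ Finset.Icc 1 s, Icc (y i - I.r) (y i + I.r) := by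
    intro p hp
    obtain ⟨i, hi, hpi⟩ := hy p ⟨hp.1, by linarith [hp.2]⟩
    rw [mem_iUnion₂]
    refine ⟨i, Finset.mem_Icc.2 ⟨hi.1, ?_⟩, hpi⟩
    by_contra! his
    linarith [h' i his hi.2, hpi.1, hp.2]
  have h1 := (measure_mono hsub).trans (measure_biUnion_finset_le (μ := volume) _ _)
  have h2 : ∀ i ∈ Finset.Icc 1 s, volume (Icc (y i - I.r) (y i + I.r)) =
      ENNReal.ofReal (2 * I.r) := by
    intro i _
    rw [Real.volume_Icc]; congr 1; ring
  rw [Real.volume_Ico, Finset.sum_congr rfl h2, Finset.sum_const, Nat.card_Icc, nsmul_eq_mul,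
    ← ENNReal.ofReal_natCast, ← ENNReal.ofReal_mul (by positivity),
    ENNReal.ofReal_le_ofReal_iff (by positivity)] at h1
  simp only [add_tsub_cancel_right] at h1
  linarith

variable {ts : List ℝ}

/-- Suppose the robot stays before `c`. If sensor `lastMoved` has negative balance, it and all later
sensors stay put beyond its attached position, and the earlier ones are too few. Otherwise no moved
sensor, and no unmoved one up to `lastMoved`, reaches the right end of the last gap. -/
theorem exists_farPoint_le (hk : 1 ≤ I.lastMoved) (h : I.Restores ts) :
    ∃ t ∈ (0 : ℝ) :: ts, I.farPoint ≤ t := by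
  by_contra! hlt
  obtain ⟨y, ⟨c', hrun, rfl⟩, hy⟩ := h
  have hr := I.r_pos
  obtain ⟨M, hM, hmax⟩ := Finset.exists_max_image ((0 : ℝ) :: ts).toFinset id ⟨0, by simp⟩
  simp only [id, List.mem_toFinset] at hM hmax
  have hMc := hlt M hM
  have hM0 := hmax 0 (by simp)
  have hmove := hrun.eq_or_le (M := M) hM0 (fun t ht => hmax t (by simp [ht]))
  by_cases hneg : I.balance I.lastMoved < 0
  · rw [I.farPoint_of_neg hneg] at hMc
    have hl := I.rightTurn_lt_x hneg
    have hxL := I.x_le_L hk I.lastMoved_le_n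
    obtain ⟨k, hk'⟩ : ∃ k, I.lastMoved = k + 1 := ⟨I.lastMoved - 1, by omega⟩
    have hkn := I.lastMoved_le_n
    have hrt := I.rightTurn_eq (k + 1)
    rw [← hk'] at hrt
    have hcast : (I.lastMoved : ℝ) = k + 1 := by exact_mod_cast hk'
    rw [hcast] at hrt
    have h0 : 0 ≤ 2 * I.r * k := by positivity
    have := I.sub_lt_of_covered hy (s := k) (q := I.rightTurn I.lastMoved)
      (by linarith) (fun i hi hn => by
        have hx := I.x_le hk (j := i) (by omega) hn
        rcases hmove i with h1 | h1
        · rw [h1]; exact hl.trans_le hx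
        · have := h1.1
          simp only at this
          linarith)
    rw [hrt] at this
    linarith
  · have hnn := not_lt.1 hneg
    have hG := (I.gapEnd_lastMoved_gt hk).2 hnn
    rw [I.farPoint_of_nonneg hk hnn] at hMc
    obtain ⟨p, hp, hMp⟩ := I.exists_mem_uncoveredAfter I.lastMoved_le_n
      (max M (I.x I.lastMoved) + I.r) (by linarith [le_max_left M (I.x I.lastMoved)])
      (by rw [← lt_sub_iff_add_lt]; exact max_lt hMc (by linarith))
    obtain ⟨i, hi, hpi⟩ := hy p hp.1
    have h1 := le_max_left M (I.x I.lastMoved)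
    have h2 := le_max_right M (I.x I.lastMoved)
    rcases hmove i with h3 | h3
    · simp only at h3
      rw [h3] at hpi
      by_cases hik : i ≤ I.lastMoved
      · linarith [hpi.2, I.x_le hi.1 hik I.lastMoved_le_n]
      · exact hp.2 i ⟨by omega, hi.2⟩ hpi
    · linarith [hpi.2, h3.2]

/-- Let `i ≥ b` be the first index with `x i > q`. If `q` is not crossed to the left, sensors `i, …,
n` stay beyond `q`, and counting gives `q < rightTurn i`. For `i = b` this contradicts the choice of
`q`. For `i > b`, sensor `i - 1` has balance at most `-2r`, so it already starts at or after
`rightTurn i`, contradicting minimality. -/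
theorem leftCross_of_mem_Ioo (h : I.Restores ts) {b a : ℕ} (hb : 1 ≤ b) (hba : b ≤ a)
    (han : a ≤ I.n) (hdeep : ∀ i, b ≤ i → i < a → I.balance i ≤ -2 * I.r) {q : ℝ}
    (hq : q ∈ Ioo (I.rightTurn b) (I.x a)) : LeftCross q 0 ts := by
  obtain ⟨y, ⟨c', hrun, rfl⟩, hy⟩ := h
  by_contra hcross
  classical
  have hr := I.r_pos
  have hex : ∃ i, b ≤ i ∧ q < I.x i := ⟨a, hba, hq.2⟩
  obtain ⟨hbi, hqi⟩ := Nat.find_spec hex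
  have hia : Nat.find hex ≤ a := Nat.find_min' hex ⟨hba, hq.2⟩
  have hmin : ∀ j < Nat.find hex, b ≤ j → I.x j ≤ q := fun j hj hbj => by
    by_contra! h1
    exact Nat.find_min hex hj ⟨hbj, h1⟩
  set i := Nat.find hex
  obtain ⟨s, hs⟩ : ∃ s, i = s + 1 := ⟨i - 1, by omega⟩
  have hrb := I.rightTurn_mono hb
  have hr1 := I.rightTurn_eq 1
  push_cast at hr1
  have h1 := I.sub_lt_of_covered hy (s := s) (q := q)
    (by linarith [hq.2, I.x_le_L (by omega) han]) (fun j hj hn => by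
      refine hrun.gt_of_not_leftCross hcross ?_
      exact hqi.trans_le (I.x_le (by omega) (by omega) hn))
  have h2 : q < I.rightTurn i := by
    rw [rightTurn_eq, hs]; push_cast; linarith
  rcases eq_or_lt_of_le hbi with h3 | h3
  · rw [← h3] at h2
    linarith [hq.1]
  · have h4 := hdeep s (by omega) (by omega)
    have h5 := hmin s (by omega) (by omega)
    rw [hs, rightTurn_succ] at h2
    rw [balance_eq] at h4
    linarith

/-! ### The lower bound -/

theorem le_volume_of_Ioo_subset {W : Set ℝ} (hW : volume W ≠ ⊤) {u v : ℝ}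
    (h : Ioo u v ⊆ W) : v - u ≤ (volume W).toReal := by
  have h1 := measure_mono (μ := volume) h
  rw [Real.volume_Ioo] at h1
  exact (ENNReal.ofReal_le_iff_le_toReal hW).1 h1

/-- The threshold `s` separates the part of `W` already charged to earlier triples. A pair with `x a
< e` is charged as a triple; at the first pair with `e ≤ x a` the remaining bound is that of a
double, and if there is none, `[e, c)` pays for ending at `c`. -/
theorem exists_excess_le {e : ℝ} {W : Set ℝ} (hW : volume W ≠ ⊤)
    (hc : ∀ q, e ≤ q → q < I.farPoint → q ∈ W) {p : ℕ} {D : List (ℕ × ℕ)}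
    (hD : I.Delimits p D) : ∀ s : ℝ, s ≤ e →
      (∀ i, p < i → i ≤ I.n → I.balance i < 0 → s ≤ I.rightTurn i) →
      (∀ d ∈ D, Ioo (I.rightTurn d.1) (I.x d.2) ⊆ W) →
      ∃ j ≤ D.length, I.farPoint + I.excess D j ≤ e + 2 * (volume (W ∩ Ioi s)).toReal := by
  have hfin : ∀ s, volume (W ∩ Ioi s) ≠ ⊤ := fun s => measure_ne_top_of_subset inter_subset_left hW
  induction hD with
  | nil h =>
    intro s hse _ _
    refine ⟨0, le_rfl, ?_⟩
    have h1 := le_volume_of_Ioo_subset (hfin s) (u := e) (v := I.farPoint)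
      (fun q hq => ⟨hc q hq.1.le hq.2, hse.trans_lt hq.1⟩)
    have h2 : 0 ≤ (volume (W ∩ Ioi s)).toReal := ENNReal.toReal_nonneg
    simp only [excess]
    linarith
  | @cons p b a D hpb hba han hpos hneg hdeep hnext hD ih =>
    intro s hse hs hsub
    have hbs := hs b hpb (hba.trans han) (hneg b le_rfl hba)
    have hsub1 := hsub (b, a) (by simp)
    simp only at hsub1
    by_cases hea : e ≤ I.x a
    · refine ⟨0, Nat.zero_le _, ?_⟩
      -- Since `e ≤ x a`, the segment of the pair and `[e, c)` leave no hole between the left end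
      -- and `c`. Ending before or after `rightTurn b` only costs more than ending there.
      have h1 := le_volume_of_Ioo_subset (hfin s) (u := min e (I.rightTurn b)) (v := I.farPoint)
        (fun q hq => by
          refine ⟨?_, (le_min hse hbs).trans_lt hq.1⟩
          rcases le_or_gt e q with h | h
          · exact hc q h hq.2
          · have := (min_lt_iff.1 hq.1).resolve_left h.not_gt
            exact hsub1 ⟨this, h.trans_le hea⟩)
      simp only [excess]
      rcases le_total e (I.rightTurn b) with h | h
      · rw [min_eq_left h] at h1
        linarith
      · rw [min_eq_right h] at h1
        linarith
    · obtain ⟨j, hj, h1⟩ := ih (I.x a) (not_le.1 hea).le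
        (fun i h1 h2 h3 => (hnext i h1 h2 h3).le) (fun d hd => hsub d (by simp [hd]))
      refine ⟨j + 1, by simpa using hj, ?_⟩
      have hba' : I.rightTurn b < I.x a :=
        (I.rightTurn_lt_x (hneg b le_rfl hba)).trans_le (I.x_le (by omega) hba han)
      -- The segment of this triple is disjoint from what the induction charges, which lies beyond
      -- `x a`.
      have h2 : volume (Ioo (I.rightTurn b) (I.x a)) + volume (W ∩ Ioi (I.x a)) ≤
          volume (W ∩ Ioi s) := by
        rw [← measure_union' _ measurableSet_Ioo]
        · refine measure_mono (union_subset (fun q hq => ⟨hsub1 hq, hbs.trans_lt hq.1⟩) ?_)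
          exact inter_subset_inter_right _ (Ioi_subset_Ioi (hbs.trans hba'.le))
        · rw [Set.disjoint_left]
          intro q hq hq'
          exact absurd hq.2 (not_lt.2 (le_of_lt hq'.2))
      have h3 := ENNReal.toReal_mono (hfin s) h2
      rw [ENNReal.toReal_add (by rw [Real.volume_Ioo]; exact ENNReal.ofReal_ne_top) (hfin _),
        Real.volume_Ioo, ENNReal.toReal_ofReal (by linarith)] at h3
      simp only [excess]
      linarith

theorem Delimits.mem {p : ℕ} {D : List (ℕ × ℕ)} (hD : I.Delimits p D) :
    ∀ d ∈ D, 1 ≤ d.1 ∧ d.1 ≤ d.2 ∧ d.2 ≤ I.n ∧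
      ∀ i, d.1 ≤ i → i < d.2 → I.balance i ≤ -2 * I.r := by
  induction hD with
  | nil h => simp
  | cons h1 h2 h3 h4 h5 h6 h7 _ ih =>
    intro d hd
    rcases List.mem_cons.1 hd with rfl | hd
    · exact ⟨by omega, h2, h3, h6⟩
    · exact ih d hd

theorem le_pathLength (hk : 1 ≤ I.lastMoved) (ht : I.IsTrajectory ts) (h : I.Restores ts) :
    I.farPoint + I.overhead I.bestIndex ≤ pathLength 0 ts := by
  have hv := volume_leftCross_le 0 ts
  have hW : volume {q | LeftCross q 0 ts} ≠ ⊤ := ne_top_of_le_ne_top ENNReal.ofReal_ne_top hv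
  have he : 0 ≤ ts.getLastD 0 := by
    by_cases hnil : ts = []
    · simp [hnil]
    · rw [List.getLastD_eq_getLast?, List.getLast?_eq_some_getLast hnil]
      exact (ht.1 _ (List.getLast_mem hnil)).1
  obtain ⟨t, htm, hct⟩ := I.exists_farPoint_le hk h
  obtain ⟨j, hj, h1⟩ := I.exists_excess_le (e := ts.getLastD 0) hW
    (fun q h1 h2 => leftCross_of_last_le ⟨t, htm, h2.trans_le hct⟩ h1) I.delimits_delimiters 0 he
    (fun i hi _ _ => (I.rightTurn_pos hi).le)
    (fun d hd q hq => by
      obtain ⟨h1, h2, h3, h4⟩ := Delimits.mem I I.delimits_delimiters d hd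
      exact I.leftCross_of_mem_Ioo h h1 h2 h3 h4 hq)
  have h2 := I.bestIndex_spec.2 j hj
  rw [I.overhead_eq j] at h2
  have h3 : (volume ({q | LeftCross q 0 ts} ∩ Ioi 0)).toReal ≤ leftLength 0 ts := by
    rw [← ENNReal.toReal_ofReal (leftLength_nonneg 0 ts)]
    exact ENNReal.toReal_mono ENNReal.ofReal_ne_top
      ((measure_mono inter_subset_left).trans hv)
  rw [pathLength_eq]
  linarith

/-! ### Optimality -/

theorem offline_of_covered (h : I.Covered I.x) : I.offline = [] := by simp [offline, h]

theorem offline_of_not_covered (h : ¬ I.Covered I.x) :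
    I.offline = I.trajectory I.bestIndex := by simp [offline, h]

theorem offline_correct : I.IsOptimal I.offline ∧
    (∃ y, I.Produces I.offline y ∧ I.Covered y ∧ I.OrderPreserving y ∧
      I.FullyStretched I.offline y) ∧
    (¬ I.Covered I.x → ∃ j ≤ I.delimiters.length,
      I.offline = I.trajectory j ∧ (0 :: I.breakpoints j).Pairwise (· < ·) ∧
      pathLength 0 I.offline = I.farPoint + I.overhead j ∧
      ∀ i ≤ I.delimiters.length, I.overhead j ≤ I.overhead i) := by
  by_cases hcov : I.Covered I.x
  · have hprod : I.Produces [] I.x := ⟨_, .nil _, rfl⟩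
    rw [I.offline_of_covered hcov]
    refine ⟨⟨⟨by simp, trivial⟩, ⟨_, hprod, hcov⟩, fun ts' _ _ => ?_⟩,
      ⟨_, hprod, hcov, I.x_mono, fun i hi h => ?_⟩, fun h => absurd hcov h⟩
    · exact pathLength_nonneg 0 ts'
    · exact absurd h (not_lt.2 (I.x_nonneg hi.1 hi.2))
  · have hk : 1 ≤ I.lastMoved := by
      rw [covered_iff] at hcov; omega
    have hbr := I.breaks_bestIndex_pairwise hk
    obtain ⟨halt, hlen⟩ := I.path_alternating _ _ _ hbr
    have hmem := I.path_mem _ _ _ hbr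
    have hprod := I.produces_trajectory hk I.bestIndex
    rw [← trajectory_eq] at halt hlen hmem
    rw [← overhead_eq, sub_zero] at hlen
    rw [I.offline_of_not_covered hcov]
    refine ⟨⟨⟨fun t ht => ?_, halt⟩, ⟨_, hprod, I.final_covered hk⟩, fun ts' h1 h2 => ?_⟩,
      ⟨_, hprod, I.final_covered hk, I.final_monotone, fun i hi h => ?_⟩, fun _ => ?_⟩
    · exact ⟨(hmem t ht).1.le, (hmem t ht).2.trans (I.farPoint_le_L hk)⟩
    · rw [hlen]
      exact I.le_pathLength hk h1 h2
    · refine I.final_eq_of_lt hi (h.trans_le ?_)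
      rw [termination, List.getLastD_eq_getLast?]
      by_cases hnil : I.trajectory I.bestIndex = []
      · rw [hnil]
        exact (I.farPoint_pos hk).le
      · rw [List.getLast?_eq_some_getLast hnil]
        exact (hmem _ (List.getLast_mem hnil)).2
    · exact ⟨I.bestIndex, I.bestIndex_spec.1, rfl, by rwa [breakpoints_eq], hlen,
        I.bestIndex_spec.2⟩

end Barrier

end BarrierRobot

end

/-! ### A verified compiler from structured commands to the real RAM -/

noncomputable section

namespace BarrierRobot

/-! ### A structured language for the machine -/

/-- A machine state in terms of 16 index variables and 10 real variables. -/
structure Store where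
  iv : Fin 16 → ℕ
  rv : Fin 10 → ℝ
  out : List ℝ

/-- Content of the real memory: the input in the cells `0, …, n + 1`, and after that the
real variables. -/
def Store.cell (I : Barrier) (σ : Store) (a : ℕ) : ℝ :=
  if a ≤ I.n + 1 then I.input.mem a
  else if h : a - (I.n + 2) < 10 then σ.rv ⟨a - (I.n + 2), h⟩ else 0

/-- Content of the index registers: the index variables, and after that the addresses of the first
`V` real variables. -/
def Store.reg (I : Barrier) (V : ℕ) (σ : Store) (v : ℕ) : ℕ :=
  if h : v < 16 then σ.iv ⟨v, h⟩ else if v < 16 + V then I.n + 2 + (v - 16) else 0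

/-- The machine state that a store stands for. -/
def Store.toState (I : Barrier) (σ : Store) (pc : ℕ) : State where
  pc := pc
  idx := σ.reg I 10
  mem := σ.cell I
  out := σ.out

/-- Assignment to an index variable. -/
def Store.setI (σ : Store) (d : Fin 16) (v : ℕ) : Store :=
  { σ with iv := Function.update σ.iv d v }

/-- Assignment to a real variable. -/
def Store.setR (σ : Store) (d : Fin 10) (v : ℝ) : Store :=
  { σ with rv := Function.update σ.rv d v }

section

variable (I : Barrier) (σ : Store) (pc : ℕ)

theorem Store.idx_var (d : Fin 16) : (σ.toState I pc).idx d = σ.iv d := by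
  simp [Store.toState, Store.reg]

theorem Store.idx_ptr (d : Fin 10) : (σ.toState I pc).idx (16 + d) = I.n + 2 + d := by
  have := d.2
  simp only [Store.toState, Store.reg]
  rw [dif_neg (by omega), if_pos (by omega)]
  omega

theorem Store.get_ptr (d : Fin 10) : (σ.toState I pc).get (16 + d) = σ.rv d := by
  rw [State.get, Store.idx_ptr]
  simp [Store.toState, Store.cell]
  intro h
  omega

theorem Store.get_var (p : Fin 16) : (σ.toState I pc).get p = σ.cell I (σ.iv p) := by
  rw [State.get, Store.idx_var]
  rfl

theorem Store.putIdx (d : Fin 16) (v : ℕ) :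
    (σ.toState I pc).putIdx d v = (σ.setI d v).toState I (pc + 1) := by
  simp only [State.putIdx, Store.toState, Store.setI, State.mk.injEq, true_and, and_true]
  refine ⟨?_, rfl⟩
  funext a
  simp only [Function.update_apply, Store.reg]
  by_cases h : a < 16
  · simp [h, Fin.ext_iff]
  · have := d.2
    have h1 : a ≠ d := by omega
    simp [h, h1]

theorem Store.putReal (d : Fin 10) (v : ℝ) :
    (σ.toState I pc).putReal (16 + d) v = (σ.setR d v).toState I (pc + 1) := by
  rw [State.putReal, Store.idx_ptr]
  simp only [Store.toState, Store.setR, State.mk.injEq, true_and, and_true]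
  refine ⟨rfl, ?_⟩
  funext a
  simp only [Function.update_apply, Store.cell]
  have := d.2
  by_cases h : a ≤ I.n + 1
  · have h1 : a ≠ I.n + 2 + d := by omega
    simp [h, h1]
  · by_cases h2 : a - (I.n + 2) < 10
    · have h3 : a = I.n + 2 + d ↔ a - (I.n + 2) = d := by omega
      simp [h, h2, Fin.ext_iff, h3]
    · have h1 : a ≠ I.n + 2 + d := by omega
      simp [h, h2, h1]

end

/-- Loop-free commands. -/
inductive Cmd
  | skip
  | iset (d : Fin 16) (k : ℕ)
  | iadd (d a b : Fin 16)
  | isub (d a b : Fin 16)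
  | radd (d a b : Fin 10)
  | rsub (d a b : Fin 10)
  | load (d : Fin 10) (p : Fin 16)
  | emit (a : Fin 10)
  | seq (c₁ c₂ : Cmd)
  | ifI (a b : Fin 16) (c₁ c₂ : Cmd)
  | ifR (a b : Fin 10) (c₁ c₂ : Cmd)

infixr:60 " ;; " => Cmd.seq

open Classical in
/-- The effect of a command. The command `load` relies on the real variable `0` having value `0`;
the conditionals execute their first branch if `a ≤ b`. -/
def Cmd.eval (I : Barrier) : Cmd → Store → Store
  | skip, σ => σ
  | iset d k, σ => σ.setI d k
  | iadd d a b, σ => σ.setI d (σ.iv a + σ.iv b)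
  | isub d a b, σ => σ.setI d (σ.iv a - σ.iv b)
  | radd d a b, σ => σ.setR d (σ.rv a + σ.rv b)
  | rsub d a b, σ => σ.setR d (σ.rv a - σ.rv b)
  | load d p, σ => σ.setR d (σ.cell I (σ.iv p) + σ.rv 0)
  | emit a, σ => { σ with out := σ.out ++ [σ.rv a] }
  | seq c₁ c₂, σ => c₂.eval I (c₁.eval I σ)
  | ifI a b c₁ c₂, σ => if σ.iv a ≤ σ.iv b then c₁.eval I σ else c₂.eval I σ
  | ifR a b c₁ c₂, σ => if σ.rv a ≤ σ.rv b then c₁.eval I σ else c₂.eval I σ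

/-- A bound for the number of steps. -/
def Cmd.cost : Cmd → ℕ
  | skip => 0
  | seq c₁ c₂ => c₁.cost + c₂.cost
  | ifI _ _ c₁ c₂ => c₁.cost + c₂.cost + 2
  | ifR _ _ c₁ c₂ => c₁.cost + c₂.cost + 2
  | _ => 1

/-- A piece of code, as a function of its position in the program. -/
abbrev Code := ℕ → List Instr

/-- Sequential composition. -/
def Code.seq (C₁ C₂ : Code) : Code := fun o => C₁ o ++ C₂ (o + (C₁ o).length)

/-- A conditional that branches with the jump instruction `j`. -/
def Code.cond (j : ℕ → Instr) (C₁ C₂ : Code) : Code := fun o =>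
  j (o + 1 + (C₂ (o + 1)).length + 1) :: (C₂ (o + 1) ++
    .jumpIdxLE 0 0 (o + 1 + (C₂ (o + 1)).length + 1 +
      (C₁ (o + 1 + (C₂ (o + 1)).length + 1)).length) ::
    C₁ (o + 1 + (C₂ (o + 1)).length + 1))

/-- Repetition of a piece of code while index variable `a` is at most index variable `b`. -/
def Code.loop (a b : Fin 16) (C : Code) : Code := fun o =>
  .jumpIdxLE a b (o + 2) :: .jumpIdxLE 0 0 (o + 2 + (C (o + 2)).length + 1) ::
    (C (o + 2) ++ [.jumpIdxLE 0 0 o])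

/-- Translation of commands. -/
def Cmd.code : Cmd → Code
  | skip => fun _ => []
  | iset d k => fun _ => [.setIdx d k]
  | iadd d a b => fun _ => [.addIdx d a b]
  | isub d a b => fun _ => [.subIdx d a b]
  | radd d a b => fun _ => [.addReal (16 + d) (16 + a) (16 + b)]
  | rsub d a b => fun _ => [.subReal (16 + d) (16 + a) (16 + b)]
  | load d p => fun _ => [.addReal (16 + d) p (16 + (0 : Fin 10))]
  | emit a => fun _ => [.emit (16 + a)]
  | seq c₁ c₂ => Code.seq c₁.code c₂.code
  | ifI a b c₁ c₂ => Code.cond (.jumpIdxLE a b) c₁.code c₂.code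
  | ifR a b c₁ c₂ => Code.cond (.jumpRealLE (16 + a) (16 + b)) c₁.code c₂.code

/-- Wherever the code is placed in a program, it takes store `σ` to store `σ'` in at most
`T` steps. -/
def Exec (I : Barrier) (C : Code) (σ σ' : Store) (T : ℕ) : Prop :=
  ∀ pre post : List Instr, ∃ t ≤ T,
    (step (pre ++ C pre.length ++ post))^[t] (σ.toState I pre.length) =
      σ'.toState I (pre.length + (C pre.length).length)

theorem step_of_append {pre post : List Instr} {i : Instr} {s : State} (h : s.pc = pre.length) :
    step (pre ++ i :: post) s = i.exec s := by
  simp [step, h]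

section

variable {I : Barrier} {σ σ' σ'' : Store} {T T₁ T₂ : ℕ} {C C₁ C₂ : Code}

theorem Exec.instr {i : Instr}
    (h : ∀ pc, i.exec (σ.toState I pc) = σ'.toState I (pc + 1)) :
    Exec I (fun _ => [i]) σ σ' 1 := by
  intro pre post
  refine ⟨1, le_rfl, ?_⟩
  rw [Function.iterate_one, List.append_assoc, List.singleton_append, step_of_append rfl, h]
  rfl

theorem Exec.seq (h₁ : Exec I C₁ σ σ' T₁) (h₂ : Exec I C₂ σ' σ'' T₂) :
    Exec I (Code.seq C₁ C₂) σ σ'' (T₁ + T₂) := by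
  intro pre post
  obtain ⟨t₁, ht₁, h₁⟩ := h₁ pre (C₂ (pre.length + (C₁ pre.length).length) ++ post)
  obtain ⟨t₂, ht₂, h₂⟩ := h₂ (pre ++ C₁ pre.length) post
  refine ⟨t₂ + t₁, by omega, ?_⟩
  simp only [List.length_append, List.append_assoc] at h₁ h₂
  simp only [Code.seq, List.length_append, List.append_assoc]
  rw [Function.iterate_add_apply, h₁, h₂, add_assoc]

open Classical in
theorem Exec.cond {j : ℕ → Instr} {q : Prop}
    (hj : ∀ l pc, (j l).exec (σ.toState I pc) = σ.toState I (if q then l else pc + 1))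
    (h₁ : q → Exec I C₁ σ σ' T₁) (h₂ : ¬ q → Exec I C₂ σ σ' T₂) :
    Exec I (Code.cond j C₁ C₂) σ σ' (T₁ + T₂ + 2) := by
  intro pre post
  set e := C₂ (pre.length + 1) with he
  set c := C₁ (pre.length + 1 + e.length + 1) with hc
  -- The branch for a failed test comes first and ends with an unconditional jump over the other
  -- branch; `jumpIdxLE 0 0` always jumps.
  have hcode : Code.cond j C₁ C₂ pre.length = j (pre.length + 1 + e.length + 1) ::
      (e ++ .jumpIdxLE 0 0 (pre.length + 1 + e.length + 1 + c.length) :: c) := rfl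
  rw [hcode]
  by_cases hq : q
  · obtain ⟨t, ht, h⟩ := h₁ hq (pre ++ j (pre.length + 1 + e.length + 1) ::
      (e ++ [.jumpIdxLE 0 0 (pre.length + 1 + e.length + 1 + c.length)])) post
    have hlen : (pre ++ j (pre.length + 1 + e.length + 1) ::
      (e ++ [.jumpIdxLE 0 0 (pre.length + 1 + e.length + 1 + c.length)])).length =
        pre.length + 1 + e.length + 1 := by simp; omega
    rw [hlen, ← hc] at h
    refine ⟨t + 1, by omega, ?_⟩
    rw [Function.iterate_add_apply, Function.iterate_one]
    simp only [List.append_assoc, List.cons_append, List.nil_append, List.length_append,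
      List.length_cons] at h ⊢
    rw [step_of_append (s := σ.toState I pre.length) rfl, hj, if_pos hq, h]
    congr 1; omega
  · obtain ⟨t, ht, h⟩ := h₂ hq (pre ++ [j (pre.length + 1 + e.length + 1)])
      (.jumpIdxLE 0 0 (pre.length + 1 + e.length + 1 + c.length) :: c ++ post)
    have hlen : (pre ++ [j (pre.length + 1 + e.length + 1)]).length = pre.length + 1 := by simp
    rw [hlen, ← he] at h
    refine ⟨1 + t + 1, by omega, ?_⟩
    rw [Function.iterate_add_apply, Function.iterate_one, Function.iterate_add_apply,
      Function.iterate_one]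
    have hP : pre ++ j (pre.length + 1 + e.length + 1) ::
        (e ++ .jumpIdxLE 0 0 (pre.length + 1 + e.length + 1 + c.length) :: c) ++ post =
        (pre ++ j (pre.length + 1 + e.length + 1) :: e) ++
          .jumpIdxLE 0 0 (pre.length + 1 + e.length + 1 + c.length) :: (c ++ post) := by simp
    simp only [List.append_assoc, List.cons_append, List.nil_append, List.length_append,
      List.length_cons] at h hP ⊢
    rw [step_of_append (s := σ.toState I pre.length) rfl, hj, if_neg hq, h]
    have := step_of_append (pre := pre ++ j (pre.length + 1 + e.length + 1) :: e)
      (post := c ++ post) (i := .jumpIdxLE 0 0 (pre.length + 1 + e.length + 1 + c.length))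
      (s := σ'.toState I (pre.length + 1 + e.length)) (by simp [Store.toState]; omega)
    simp only [List.append_assoc, List.cons_append] at this
    rw [this]
    simp only [Instr.exec, le_refl, if_true, Store.toState, State.mk.injEq, and_true]
    omega

theorem Cmd.exec (c : Cmd) (σ : Store) : Exec I c.code σ (c.eval I σ) c.cost := by
  induction c generalizing σ with
  | skip => exact fun pre post => ⟨0, le_rfl, rfl⟩
  | iset d k => exact .instr fun pc => Store.putIdx ..
  | iadd d a b =>
    refine .instr fun pc => ?_
    rw [Instr.exec, Store.putIdx, Store.idx_var, Store.idx_var]; rfl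
  | isub d a b =>
    refine .instr fun pc => ?_
    rw [Instr.exec, Store.putIdx, Store.idx_var, Store.idx_var]; rfl
  | radd d a b =>
    refine .instr fun pc => ?_
    rw [Instr.exec, Store.putReal, Store.get_ptr, Store.get_ptr]; rfl
  | rsub d a b =>
    refine .instr fun pc => ?_
    rw [Instr.exec, Store.putReal, Store.get_ptr, Store.get_ptr]; rfl
  | load d p =>
    refine .instr fun pc => ?_
    rw [Instr.exec, Store.putReal, Store.get_ptr, Store.get_var]; rfl
  | emit a =>
    refine .instr fun pc => ?_
    rw [Instr.exec, Store.get_ptr]; rfl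
  | seq c₁ c₂ ih₁ ih₂ => exact (ih₁ σ).seq (ih₂ _)
  | ifI a b c₁ c₂ ih₁ ih₂ =>
    refine .cond (q := σ.iv a ≤ σ.iv b) (fun l pc => ?_) (fun h => ?_) (fun h => ?_)
    · rw [Instr.exec, Store.idx_var, Store.idx_var]; split_ifs <;> rfl
    · rw [Cmd.eval, if_pos h]; exact ih₁ σ
    · rw [Cmd.eval, if_neg h]; exact ih₂ σ
  | ifR a b c₁ c₂ ih₁ ih₂ =>
    refine .cond (q := σ.rv a ≤ σ.rv b) (fun l pc => ?_) (fun h => ?_) (fun h => ?_)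
    · rw [Instr.exec, Store.get_ptr, Store.get_ptr]; split_ifs <;> rfl
    · rw [Cmd.eval, if_pos h]; exact ih₁ σ
    · rw [Cmd.eval, if_neg h]; exact ih₂ σ

/-- Each round adds two steps to the body, the test and the jump back; leaving costs the failed test
and the exit jump. -/
theorem Exec.loop {a b : Fin 16} {B : ℕ} {f : ℕ → Store} (N : ℕ) :
    (∀ t < N, (f t).iv a ≤ (f t).iv b ∧ Exec I C (f t) (f (t + 1)) B) →
    ¬ (f N).iv a ≤ (f N).iv b → Exec I (Code.loop a b C) (f 0) (f N) (N * (B + 2) + 2) := by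
  induction N generalizing f with
  | zero =>
    intro _ hN pre post
    refine ⟨2, by omega, ?_⟩
    rw [Function.iterate_succ_apply, Function.iterate_one]
    simp only [Code.loop, List.append_assoc, List.cons_append]
    rw [step_of_append (s := (f 0).toState I pre.length) rfl, Instr.exec, Store.idx_var, Store.idx_var, if_neg hN]
    have := step_of_append (pre := pre ++ [.jumpIdxLE a b (pre.length + 2)])
      (post := C (pre.length + 2) ++ [.jumpIdxLE 0 0 pre.length] ++ post)
      (i := .jumpIdxLE 0 0 (pre.length + 2 + (C (pre.length + 2)).length + 1))
      (s := (f 0).toState I (pre.length + 1)) (by simp [Store.toState])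
    simp only [List.append_assoc, List.cons_append, List.nil_append] at this
    refine this.trans ?_
    simp only [Instr.exec, le_refl, if_true, Store.toState, State.mk.injEq, and_true,
      List.length_cons, List.length_append, List.length_nil]
    omega
  | succ N ih =>
    intro h hN pre post
    obtain ⟨h0, hbody⟩ := h 0 (by omega)
    obtain ⟨t₂, ht₂, h₂⟩ := ih (f := fun t => f (t + 1)) (fun t ht => h (t + 1) (by omega)) hN
      pre post
    obtain ⟨t₁, ht₁, h₁⟩ := hbody (pre ++ [Instr.jumpIdxLE a b (pre.length + 2),
      Instr.jumpIdxLE 0 0 (pre.length + 2 + (C (pre.length + 2)).length + 1)])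
      (Instr.jumpIdxLE 0 0 pre.length :: post)
    have hlen : (pre ++ [Instr.jumpIdxLE a b (pre.length + 2),
      Instr.jumpIdxLE 0 0 (pre.length + 2 + (C (pre.length + 2)).length + 1)]).length =
        pre.length + 2 := by simp
    rw [hlen] at h₁
    refine ⟨t₂ + (1 + (t₁ + 1)), ?_, ?_⟩
    · rw [Nat.succ_mul]; omega
    rw [Function.iterate_add_apply, Function.iterate_add_apply, Function.iterate_add_apply]
    simp only [Function.iterate_one]
    refine Eq.trans ?_ h₂
    congr 1
    simp only [Code.loop, List.append_assoc, List.cons_append, List.nil_append] at h₁ ⊢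
    rw [step_of_append (s := (f 0).toState I pre.length) rfl, Instr.exec, Store.idx_var, Store.idx_var, if_pos h0]
    refine (congrArg _ h₁).trans ?_
    have := step_of_append (pre := pre ++ [Instr.jumpIdxLE a b (pre.length + 2),
      Instr.jumpIdxLE 0 0 (pre.length + 2 + (C (pre.length + 2)).length + 1)] ++ C (pre.length + 2))
      (post := post) (i := .jumpIdxLE 0 0 pre.length)
      (s := (f 1).toState I (pre.length + 2 + (C (pre.length + 2)).length))
      (by simp [Store.toState]; omega)
    simp only [List.append_assoc, List.cons_append, List.nil_append] at this
    refine this.trans ?_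
    simp [Instr.exec, Store.toState]

/-- Every store with property `Pre` is taken by the code, in at most `T` steps, to a store with
property `Post`. -/
def Hoare (I : Barrier) (Pre : Store → Prop) (C : Code) (Post : Store → Prop) (T : ℕ) : Prop :=
  ∀ σ, Pre σ → ∃ σ', Exec I C σ σ' T ∧ Post σ'

variable {Pre Mid Post : Store → Prop}

theorem Hoare.seq (h₁ : Hoare I Pre C₁ Mid T₁) (h₂ : Hoare I Mid C₂ Post T₂) :
    Hoare I Pre (Code.seq C₁ C₂) Post (T₁ + T₂) := by
  intro σ hσ
  obtain ⟨σ', h, hσ'⟩ := h₁ σ hσ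
  obtain ⟨σ'', h', hσ''⟩ := h₂ σ' hσ'
  exact ⟨σ'', h.seq h', hσ''⟩

theorem Hoare.cmd {c : Cmd} (h : ∀ σ, Pre σ → Post (c.eval I σ)) :
    Hoare I Pre c.code Post c.cost :=
  fun σ hσ => ⟨_, c.exec σ, h σ hσ⟩

/-- The number of rounds is fixed in advance, so an invariant indexed by the round gives both
termination and the step bound. -/
theorem Hoare.loop {a b : Fin 16} {c : Cmd} {Inv : ℕ → Store → Prop} (N : ℕ)
    (hpos : ∀ t < N, ∀ σ, Inv t σ → σ.iv a ≤ σ.iv b ∧ Inv (t + 1) (c.eval I σ))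
    (hneg : ∀ σ, Inv N σ → ¬ σ.iv a ≤ σ.iv b) :
    Hoare I (Inv 0) (Code.loop a b c.code) (Inv N) (N * (c.cost + 2) + 2) := by
  intro σ hσ
  have hinv : ∀ t ≤ N, Inv t ((c.eval I)^[t] σ) := by
    intro t
    induction t with
    | zero => exact fun _ => hσ
    | succ t ih =>
      intro ht
      rw [Function.iterate_succ_apply']
      exact (hpos t (by omega) _ (ih (by omega))).2
  refine ⟨_, Exec.loop (f := fun t => (c.eval I)^[t] σ) N (fun t ht => ⟨?_, ?_⟩) ?_,
    hinv N le_rfl⟩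
  · exact (hpos t ht _ (hinv t ht.le)).1
  · simp only [Function.iterate_succ_apply']
    exact c.exec _
  · exact hneg _ (hinv N le_rfl)

end

/-! ### Initialization -/

/-- The store in which the program starts after initialization. -/
def Barrier.store (I : Barrier) : Store where
  iv := fun i => if i = 0 then I.n else if i = 1 then 1 else if i = 2 then 2 else 0
  rv := fun _ => 0
  out := []

/-- Code that writes the addresses of the first `V + 1` real variables into index registers. -/
def initCode : ℕ → List Instr
  | 0 => [.setIdx 1 1, .setIdx 2 2, .addIdx 16 0 2]
  | V + 1 => initCode V ++ [.addIdx (17 + V) (16 + V) 1]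

theorem length_initCode (V : ℕ) : (initCode V).length = V + 3 := by
  induction V with
  | zero => rfl
  | succ V ih => simp [initCode, ih]

theorem Barrier.store_cell (I : Barrier) : I.store.cell I = I.input.mem := by
  funext a
  simp only [Store.cell, Barrier.store, dite_eq_ite, ite_self, Barrier.input]
  by_cases h : a ≤ I.n + 1
  · simp [h]
  · have h1 : a ≠ 0 := by omega
    have h2 : a ≠ 1 := by omega
    simp [h1, h2, h]

theorem run_initCode (I : Barrier) (V : ℕ) : ∀ post : List Instr,
    (step (initCode V ++ post))^[V + 3] I.input =
      { pc := V + 3, idx := I.store.reg I (V + 1), mem := I.store.cell I, out := [] } := by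
  induction V with
  | zero =>
    intro post
    rw [I.store_cell]
    simp only [Function.iterate_succ_apply, Function.iterate_zero, id, initCode, step,
      List.cons_append, List.nil_append, Instr.exec, State.putIdx, Barrier.input,
      List.getElem?_cons_zero, List.getElem?_cons_succ, zero_add, State.mk.injEq, true_and,
      and_true]
    funext a
    simp only [Function.update_apply, Store.reg, Barrier.store, Fin.ext_iff]
    by_cases h : a < 16
    · have h1 : a ≠ 16 := by omega
      by_cases h0 : a = 0
      · subst h0; simp
      by_cases h2 : a = 1
      · subst h2; simp
      by_cases h3 : a = 2
      · subst h3; simp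
      simp [h, h0, h1, h2, h3]
    · have h1 : a ≠ 0 := by omega
      have h2 : a ≠ 1 := by omega
      have h3 : a ≠ 2 := by omega
      by_cases h16 : a = 16
      · subst h16; simp
      have h17 : ¬ a < 17 := by omega
      simp [h, h1, h2, h3, h16, h17]
  | succ V ih =>
    intro post
    rw [initCode, List.append_assoc, List.singleton_append, show V + 1 + 3 = 1 + (V + 3) by omega,
      Function.iterate_add_apply, ih, Function.iterate_one,
      step_of_append (by simp [length_initCode])]
    simp only [Instr.exec, State.putIdx, State.mk.injEq, and_true]
    refine ⟨by omega, ?_⟩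
    funext a
    simp only [Function.update_apply, Store.reg]
    by_cases h : a < 16
    · have h1 : a ≠ 17 + V := by omega
      simp [h, h1]
    · by_cases h1 : a = 17 + V
      · subst h1
        rw [if_pos rfl, dif_neg h, if_pos (by omega), dif_neg (by omega), if_pos (by omega)]
        rw [if_pos (by omega)]
        simp [Barrier.store]
        omega
      · have h2 : a < 16 + (V + 1) ↔ a < 16 + (V + 1 + 1) := by omega
        simp [h, h1, h2]

/-- Real operands are addressed through registers, so ten registers must first point to the ten
cells after the input. This takes the first twelve instructions, and the compiled code starts at
position `12`. -/
theorem Hoare.computes {I : Barrier} {C : Code} {T : ℕ} {out : List ℝ}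
    (h : Hoare I (· = I.store) C (fun σ => σ.out = out) T) :
    Computes (initCode 9 ++ C 12) I out (12 + T) := by
  obtain ⟨σ', h, hout⟩ := h _ rfl
  obtain ⟨t, ht, h⟩ := h (initCode 9) []
  rw [length_initCode, List.append_nil] at h
  have h0 := run_initCode I 9 (C 12)
  refine ⟨t + 12, by omega, ?_⟩
  rw [Function.iterate_add_apply, h0]
  have hs : ({ pc := 9 + 3, idx := I.store.reg I (9 + 1), mem := I.store.cell I, out := [] } :
    State) = I.store.toState I 12 := rfl
  rw [hs, h]
  exact ⟨by simp [Store.toState, length_initCode], hout⟩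

end BarrierRobot

end

/-! ### The linear-time program and its verification -/

noncomputable section

namespace BarrierRobot

/-! ### The program

Index variables: `0` holds `n`, `1` and `2` hold the constants `1` and `2`, `10` holds `0`; `3` is
the current sensor, `4` an address, `5` the number of moved sensors, `6` tells whether there is
an open triple, `7` counts the delimiters, `8` is the best index, `9` marks left turns.

Real variables: `0` holds `0`, `1` holds `r`, `2` holds `2r`; `3` is the current multiple of `2r` or
attached position, `4` the right end of the gap and then the rightmost point, `5` the position of a
sensor, `6` the start of the open triple, `7` the length of the triples so far, `8` the best
overhead so far, `9` a temporary. -/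

namespace Cmd

/-- Loads the range of the sensors. -/
def start : Cmd := .load 1 1 ;; .radd 2 1 1 ;; .iset 3 1

/-- Body of the loop that computes `2rn`. -/
def sumBody : Cmd := .radd 3 3 2 ;; .iadd 3 3 1

/-- Prepares the search for the number of moved sensors. -/
def gapStart : Cmd :=
  .load 4 10 ;; .radd 8 4 0 ;; .radd 7 3 0 ;; .iadd 5 0 10 ;; .isub 3 3 1

/-- Body of the loop that searches the number of moved sensors. -/
def gapBody : Cmd :=
  .iadd 4 3 1 ;; .load 5 4 ;; .radd 9 5 1 ;; .ifR 4 9 (.rsub 4 5 1) .skip ;;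
    .rsub 3 3 2 ;; .isub 3 3 1 ;;
    .ifR 4 3 (.iadd 5 3 10 ;; .radd 8 4 0 ;; .radd 7 3 0) .skip

/-- Prepares a pass over the delimiters. -/
def scanStart : Cmd := .iset 3 1 ;; .rsub 3 0 1 ;; .iset 6 0 ;; .iset 7 0

/-- Computes the rightmost point. -/
def farCmd : Cmd :=
  .iadd 4 5 1 ;; .load 5 4 ;; .rsub 9 7 1 ;; .ifR 5 9 (.rsub 4 8 1) (.radd 4 5 0) ;;
    .radd 7 0 0 ;; scanStart

/-- Finds out whether the current sensor is at a left-turning point. -/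
def detect : Cmd :=
  .iset 9 0 ;; .radd 3 3 2 ;; .iadd 4 3 1 ;; .load 5 4 ;;
    .ifR 5 3 .skip
      (.ifI 1 6 .skip (.iset 6 1 ;; .radd 6 3 0) ;; .radd 9 3 2 ;;
        .ifR 9 5
          (.ifR 5 9
            (.ifI 0 3 .skip (.iadd 4 4 1 ;; .load 9 4 ;; .ifR 9 5 (.iset 9 1) .skip)) .skip)
          (.iset 9 1))

/-- Body of a pass over the delimiters. -/
def scanBody (inner : Cmd) : Cmd :=
  detect ;; .ifI 1 9 (inner ;; .iset 6 0) .skip ;; .iadd 3 3 1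

/-- Compares a new overhead with the best one so far. -/
def update : Cmd :=
  .ifI 7 10 (.radd 8 9 0 ;; .iadd 8 7 10) (.ifR 8 9 .skip (.radd 8 9 0 ;; .iadd 8 7 10))

/-- Computes the overhead of the trajectory with a double at the current delimiters. -/
def overheadBody : Cmd :=
  .rsub 9 4 6 ;; .radd 9 9 7 ;; update ;; .rsub 9 5 6 ;; .radd 9 9 9 ;; .radd 7 7 9 ;;
    .iadd 7 7 1

/-- Treats the overhead of the trajectory without a double, and prepares the second pass. -/
def overheadEnd : Cmd := .radd 9 7 0 ;; update ;; scanStart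

/-- Output at the current delimiters. -/
def emitBody : Cmd :=
  .ifI 1 5 (.ifI 8 7 (.ifI 7 8 (.emit 4 ;; .emit 6) .skip) (.emit 5 ;; .emit 6)) .skip ;;
    .iadd 7 7 1

/-- Output at the end of the trajectory without a double. -/
def emitEnd : Cmd := .ifI 1 5 (.ifI 7 8 (.emit 4) .skip) .skip

end Cmd

/-- The values of the variables that never change. -/
def Store.Std (I : Barrier) (σ : Store) : Prop :=
  σ.iv 0 = I.n ∧ σ.iv 1 = 1 ∧ σ.iv 2 = 2 ∧ σ.iv 10 = 0 ∧ σ.rv 0 = 0 ∧ σ.rv 1 = I.r ∧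
    σ.rv 2 = 2 * I.r

section

variable {I : Barrier} {σ : Store}

theorem Store.cell_zero : σ.cell I 0 = I.L := by simp [Store.cell, Barrier.input]

theorem Store.cell_one : σ.cell I 1 = I.r := by simp [Store.cell, Barrier.input]

theorem Store.cell_succ {i : ℕ} (h1 : 1 ≤ i) (hn : i ≤ I.n) : σ.cell I (i + 1) = I.x i := by
  have h2 : i ≠ 0 := by omega
  simp [Store.cell, Barrier.input, hn, h2]

/-- Restates the condition through the `≤` tests that the machine can perform; `x (i + 1)` is
compared only after `i < n` is known. -/
theorem Barrier.isLeftTurn_iff {i : ℕ} (h1 : 1 ≤ i) : I.IsLeftTurn i ↔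
    ¬ I.x i ≤ I.rightTurn i ∧ (¬ I.rightTurn i + 2 * I.r ≤ I.x i ∨
      (I.x i ≤ I.rightTurn i + 2 * I.r ∧ ¬ I.n ≤ i ∧ I.x (i + 1) ≤ I.x i)) := by
  have hr := I.r_pos
  simp only [Barrier.IsLeftTurn, I.balance_eq, not_le]
  constructor
  · rintro (⟨h2, h3⟩ | ⟨h2, h3, h4⟩)
    · exact ⟨by linarith, Or.inl (by linarith)⟩
    · exact ⟨by linarith, Or.inr ⟨by linarith, h3, h4.ge⟩⟩
  · rintro ⟨h2, h3⟩
    by_cases h5 : I.x i < I.rightTurn i + 2 * I.r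
    · exact Or.inl ⟨by linarith, by linarith⟩
    · obtain ⟨h3, h4, h6⟩ := h3.resolve_left h5
      exact Or.inr ⟨by linarith, h4, le_antisymm (I.x_le h1 (Nat.le_succ i) h4) h6⟩

end

variable (I : Barrier)

theorem hoare_start : Hoare I (· = I.store) Cmd.start.code
    (fun σ => σ.Std I ∧ σ.iv 3 = 0 + 1 ∧ σ.rv 3 = 2 * I.r * (0 : ℕ) ∧ σ.out = [])
    Cmd.start.cost := by
  refine Hoare.cmd ?_
  rintro σ rfl
  have h : I.store.iv 1 = 1 := rfl
  simp [Cmd.start, Cmd.eval, Store.setI, Store.setR, Store.Std, h,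
    Store.cell_one]
  simp [Barrier.store, two_mul]

/-- Index registers cannot be converted into reals, so `2rn` is accumulated by `n` additions. -/
theorem hoare_sum : Hoare I
    (fun σ => σ.Std I ∧ σ.iv 3 = 0 + 1 ∧ σ.rv 3 = 2 * I.r * (0 : ℕ) ∧ σ.out = [])
    (Code.loop 3 0 Cmd.sumBody.code)
    (fun σ => σ.Std I ∧ σ.iv 3 = I.n + 1 ∧ σ.rv 3 = 2 * I.r * I.n ∧ σ.out = [])
    (I.n * (Cmd.sumBody.cost + 2) + 2) := by
  refine Hoare.loop (Inv := fun t σ => σ.Std I ∧ σ.iv 3 = t + 1 ∧ σ.rv 3 = 2 * I.r * t ∧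
    σ.out = []) I.n ?_ ?_
  · rintro t ht σ ⟨⟨h0, h1, h2, h3, h4, h5, h6⟩, hi, hD, ho⟩
    refine ⟨by omega, ?_⟩
    simp [Cmd.sumBody, Cmd.eval, Store.setI, Store.setR, Store.Std, *]
    ring
  · rintro σ ⟨⟨h0, -⟩, hi, -⟩
    omega

/-- Invariant of the search for the number of moved sensors. -/
def GapInv (t : ℕ) (σ : Store) : Prop :=
  σ.Std I ∧ σ.iv 3 + t = I.n ∧ σ.rv 3 = 2 * I.r * σ.iv 3 ∧ σ.out = [] ∧
    σ.rv 4 = I.gapEnd (σ.iv 3) ∧ σ.iv 3 ≤ σ.iv 5 ∧ σ.iv 5 ≤ I.n ∧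
    σ.rv 8 = I.gapEnd (σ.iv 5) ∧ σ.rv 7 = 2 * I.r * σ.iv 5 ∧
    I.gapEnd (σ.iv 5) ≤ 2 * I.r * σ.iv 5 ∧
    ∀ j, σ.iv 3 ≤ j → j < σ.iv 5 → 2 * I.r * j < I.gapEnd j

theorem hoare_gapStart : Hoare I
    (fun σ => σ.Std I ∧ σ.iv 3 = I.n + 1 ∧ σ.rv 3 = 2 * I.r * I.n ∧ σ.out = [])
    Cmd.gapStart.code (GapInv I 0) Cmd.gapStart.cost := by
  refine Hoare.cmd ?_
  rintro σ ⟨⟨h0, h1, h2, h3, h4, h5, h6⟩, hi, hD, ho⟩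
  have := I.enough
  simp [Cmd.gapStart, Cmd.eval, Store.setI, Store.setR, Store.Std, GapInv,
    Store.cell_zero, I.gapEnd_n, *]
  intro j h1 h2
  omega

theorem hoare_gap : Hoare I (GapInv I 0) (Code.loop 1 3 Cmd.gapBody.code) (GapInv I I.n)
    (I.n * (Cmd.gapBody.cost + 2) + 2) := by
  refine Hoare.loop (Inv := GapInv I) I.n ?_ ?_
  · rintro t ht σ ⟨⟨h0, h1, h2, h3, h4, h5, h6⟩, hi, hD, ho, hG, hk, hkn, hgk, hdk, hP, hmin⟩
    refine ⟨by omega, ?_⟩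
    obtain ⟨i, hi'⟩ : ∃ i, σ.iv 3 = i + 1 := ⟨σ.iv 3 - 1, by omega⟩
    rw [hi'] at hi hD hG hk hmin
    have hin : i < I.n := by omega
    have hx : ∀ σ : Store, σ.cell I (i + 1 + 1) = I.x (i + 1) :=
      fun σ => Store.cell_succ (by omega) (by omega)
    have hrec := I.gapEnd_of_lt hin
    have hD' : 2 * I.r * (i + 1) - 2 * I.r = 2 * I.r * i := by ring
    push_cast at hD
    have hupd : (if I.gapEnd (i + 1) ≤ I.x (i + 1) + I.r then I.x (i + 1) - I.r
        else I.gapEnd (i + 1)) = I.gapEnd i := by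
      rw [hrec]
      split_ifs <;> first | rfl | linarith
    clear hrec
    by_cases h7 : I.gapEnd (i + 1) ≤ I.x (i + 1) + I.r
    · rw [if_pos h7] at hupd
      by_cases h8 : I.gapEnd i ≤ 2 * I.r * i
      · simp [Cmd.gapBody, Cmd.eval, Store.setI, Store.setR, Store.Std,
          GapInv, *]
        refine ⟨by omega, by omega, ?_⟩
        intro j h9 h10; omega
      · simp [Cmd.gapBody, Cmd.eval, Store.setI, Store.setR, Store.Std,
          GapInv, *]
        refine ⟨by omega, by omega, ?_⟩
        intro j h9 h10
        rcases eq_or_lt_of_le h9 with h11 | h11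
        · rw [← h11]; exact not_le.1 h8
        · exact hmin j h11 h10
    · rw [if_neg h7] at hupd
      rw [hupd] at h7
      by_cases h8 : I.gapEnd i ≤ 2 * I.r * i
      · simp [Cmd.gapBody, Cmd.eval, Store.setI, Store.setR, Store.Std,
          GapInv, *]
        refine ⟨by omega, by omega, ?_⟩
        intro j h9 h10; omega
      · simp [Cmd.gapBody, Cmd.eval, Store.setI, Store.setR, Store.Std,
          GapInv, *]
        refine ⟨by omega, by omega, ?_⟩
        intro j h9 h10
        rcases eq_or_lt_of_le h9 with h11 | h11
        · rw [← h11]; exact not_le.1 h8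
        · exact hmin j h11 h10
  · rintro σ ⟨⟨h0, h1, -⟩, hi, -⟩
    omega

/-- The search runs down to `0` and records every success, so the last recorded index is the least
one. -/
theorem GapInv.eq_lastMoved {I : Barrier} {σ : Store} (h : GapInv I I.n σ) :
    σ.iv 5 = I.lastMoved := by
  obtain ⟨-, hi, -, -, -, hk, hkn, -, -, hP, hmin⟩ := h
  refine le_antisymm ?_ (I.lastMoved_le hkn hP)
  by_contra! h
  have := hmin _ (by omega) h
  exact absurd I.lastMoved_spec.2 (not_le.2 this)

/-- State of the variables at the beginning of a pass. -/
def ScanReady (σ : Store) : Prop :=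
  σ.Std I ∧ σ.iv 3 = 1 ∧ σ.rv 3 = I.rightTurn 0 ∧ σ.iv 6 = 0

theorem hoare_far : Hoare I (GapInv I I.n) Cmd.farCmd.code
    (fun σ => ScanReady I σ ∧ σ.iv 5 = I.lastMoved ∧ σ.out = [] ∧ σ.iv 7 = 0 ∧ σ.rv 7 = 0 ∧
      (1 ≤ I.lastMoved → σ.rv 4 = I.farPoint)) Cmd.farCmd.cost := by
  refine Hoare.cmd ?_
  rintro σ h
  have hk := h.eq_lastMoved
  obtain ⟨⟨h0, h1, h2, h3, h4, h5, h6⟩, hi, hD, ho, hG, hik, hkn, hgk, hdk, hP, hmin⟩ := h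
  rw [hk] at hgk hdk
  have hr0 : I.rightTurn 0 = -I.r := by rw [I.rightTurn_eq]; simp
  have hkn' := I.lastMoved_le_n
  -- If `lastMoved = 0`, this address is that of `r` and the computed value is meaningless; hence
  -- the premise `1 ≤ lastMoved` in what follows.
  have hx : ∀ σ : Store, σ.cell I (I.lastMoved + 1) = I.input.mem (I.lastMoved + 1) := by
    intro σ
    rw [Store.cell, if_pos (by omega)]
  have hmem : 1 ≤ I.lastMoved → I.input.mem (I.lastMoved + 1) = I.x I.lastMoved :=
    fun h => (hx σ).symm.trans (Store.cell_succ h hkn')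
  by_cases hle : I.input.mem (I.lastMoved + 1) ≤ 2 * I.r * I.lastMoved - I.r
  · have hc : 1 ≤ I.lastMoved → I.gapEnd I.lastMoved - I.r = I.farPoint := fun hk1 => by
      rw [hmem hk1, ← I.rightTurn_eq] at hle
      exact (I.farPoint_of_nonneg hk1 (by rw [I.balance_eq]; linarith)).symm
    clear hmem
    simpa [Cmd.farCmd, Cmd.scanStart, Cmd.eval, Store.setI, Store.setR, ScanReady, Store.Std, h0,
      h1, h2, h3, h4, h5, h6, hk, hgk, hdk, hx, hle, ho, hr0] using hc
  · have hc : 1 ≤ I.lastMoved → I.input.mem (I.lastMoved + 1) = I.farPoint := fun hk1 => by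
      rw [hmem hk1, ← I.rightTurn_eq] at hle
      rw [hmem hk1, I.farPoint_of_neg (by rw [I.balance_eq]; linarith)]
    clear hmem
    simpa [Cmd.farCmd, Cmd.scanStart, Cmd.eval, Store.setI, Store.setR, ScanReady, Store.Std, h0,
      h1, h2, h3, h4, h5, h6, hk, hgk, hdk, hx, hle, ho, hr0] using hc

/-! ### Passes over the delimiters -/

/-- The variables that a pass over the delimiters leaves to the command executed at each of
them. -/
def Store.own (σ : Store) : ℕ × ℕ × ℕ × ℝ × ℝ × ℝ × List ℝ :=
  (σ.iv 5, σ.iv 7, σ.iv 8, σ.rv 4, σ.rv 7, σ.rv 8, σ.out)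

-- The case distinction follows the branches of the command. Variable `6` opens a triple at the
-- first negative balance, and the left-turn test is made only for negative balances.
open Classical in
theorem eval_detect {σ : Store} (hs : σ.Std I) {i : ℕ} (hi : 1 ≤ i) (hn : i ≤ I.n)
    (hσ : σ.iv 3 = i) (hD : σ.rv 3 + 2 * I.r = I.rightTurn i) (hf : σ.iv 6 = 0 ∨ σ.iv 6 = 1) :
    (Cmd.detect.eval I σ).Std I ∧ (Cmd.detect.eval I σ).own = σ.own ∧
    (Cmd.detect.eval I σ).iv 3 = i ∧ (Cmd.detect.eval I σ).rv 3 = I.rightTurn i ∧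
    (Cmd.detect.eval I σ).rv 5 = I.x i ∧
    (Cmd.detect.eval I σ).iv 9 = (if I.IsLeftTurn i then 1 else 0) ∧
    (Cmd.detect.eval I σ).iv 6 = (if I.balance i < 0 then 1 else σ.iv 6) ∧
    (Cmd.detect.eval I σ).rv 6 =
      if I.balance i < 0 ∧ σ.iv 6 = 0 then I.rightTurn i else σ.rv 6 := by
  obtain ⟨h0, h1, h2, h3, h4, h5, h6⟩ := hs
  have hx : ∀ σ : Store, σ.cell I (i + 1) = I.x i := fun σ => Store.cell_succ hi hn
  have hneg : I.balance i < 0 ↔ ¬ I.x i ≤ I.rightTurn i := by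
    rw [I.balance_eq, not_le, sub_neg]
  have hturn := Barrier.isLeftTurn_iff (I := I) hi
  by_cases c1 : I.x i ≤ I.rightTurn i
  · simp [Cmd.detect, Cmd.eval, Store.setI, Store.setR, Store.Std,
      Store.own, *]
  by_cases c2 : I.rightTurn i + 2 * I.r ≤ I.x i
  · by_cases c3 : I.x i ≤ I.rightTurn i + 2 * I.r
    · by_cases c4 : I.n ≤ i
      · rcases hf with hf | hf <;>
        simp [Cmd.detect, Cmd.eval, Store.setI, Store.setR, Store.Std,
          Store.own, *]
      · have hx' : ∀ σ : Store, σ.cell I (i + 1 + 1) = I.x (i + 1) :=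
          fun σ => Store.cell_succ (by omega) (by omega)
        by_cases c5 : I.x (i + 1) ≤ I.x i <;> rcases hf with hf | hf <;>
        simp [Cmd.detect, Cmd.eval, Store.setI, Store.setR, Store.Std,
          Store.own, *]
    · rcases hf with hf | hf <;>
      simp [Cmd.detect, Cmd.eval, Store.setI, Store.setR, Store.Std,
        Store.own, *]
  · rcases hf with hf | hf <;>
    simp [Cmd.detect, Cmd.eval, Store.setI, Store.setR, Store.Std,
      Store.own, *]

/-- A pass with a command that maintains the property `J` of the list of delimiters found so far. -/
theorem hoare_scan (inner : Cmd) (J : List (ℕ × ℕ) → Store → Prop)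
    (hJ : ∀ D σ σ', σ.own = σ'.own → J D σ → J D σ')
    (hin : ∀ D d D' σ, I.delimiters = D ++ d :: D' → σ.Std I → J D σ →
      σ.rv 6 = I.rightTurn d.1 → σ.rv 5 = I.x d.2 →
      J (D ++ [d]) (inner.eval I σ) ∧ (inner.eval I σ).Std I ∧
        (inner.eval I σ).iv 3 = σ.iv 3 ∧ (inner.eval I σ).rv 3 = σ.rv 3) :
    Hoare I (fun σ => ScanReady I σ ∧ J [] σ) (Code.loop 3 0 (Cmd.scanBody inner).code)
      (fun σ => σ.Std I ∧ J I.delimiters σ) (I.n * ((Cmd.scanBody inner).cost + 2) + 2) := by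
  -- The pairs found so far, followed by what `scan` would still produce, are always the full list;
  -- the flag and the stored attached position encode the argument `b` of `scan`.
  have hloop := Hoare.loop (I := I) (a := 3) (b := 0) (c := Cmd.scanBody inner)
    (Inv := fun t σ => σ.Std I ∧ σ.iv 3 = t + 1 ∧ σ.rv 3 = I.rightTurn t ∧
      ∃ D b, I.delimiters = D ++ I.scan b (List.range' (t + 1) (I.n - t)) ∧ J D σ ∧
        (b = 0 ∧ σ.iv 6 = 0 ∨ b ≠ 0 ∧ σ.iv 6 = 1 ∧ σ.rv 6 = I.rightTurn b)) I.n ?_ ?_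
  · intro σ hσ
    obtain ⟨⟨hs, hi, hD, hf⟩, hJ0⟩ := hσ
    obtain ⟨σ', h1, h2, -, -, D, b, h3, h4, -⟩ := hloop σ ⟨hs, by simpa using hi, hD, [], 0, by
      simp [I.delimiters_eq_scan], hJ0, Or.inl ⟨rfl, hf⟩⟩
    refine ⟨σ', h1, h2, ?_⟩
    rw [Nat.sub_self, List.range'_zero, Barrier.scan, List.append_nil] at h3
    rwa [h3]
  · rintro t ht σ ⟨hs, hi, hD, D, b, hdel, hJD, hb⟩
    refine ⟨by rw [hi, hs.1]; omega, ?_⟩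
    obtain ⟨d1, d2, d3, d4, d5, d6, d7, d8⟩ := eval_detect I hs (i := t + 1) (by omega) (by omega)
      hi (by rw [hD, I.rightTurn_succ]) (by omega)
    rw [Cmd.scanBody]
    simp only [Cmd.eval]
    generalize Cmd.detect.eval I σ = τ at *
    have hJτ := hJ _ _ _ d2.symm hJD
    rw [show I.n - t = (I.n - (t + 1)) + 1 by omega, List.range'_succ, Barrier.scan] at hdel
    have hτ1 : τ.iv 1 = 1 := d1.2.1
    by_cases hturn : I.IsLeftTurn (t + 1)
    · have hneg := I.neg_of_isLeftTurn hturn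
      rw [if_pos hturn] at hdel d6
      have hlb : τ.rv 6 = I.rightTurn (if b = 0 then t + 1 else b) := by
        rw [d8]
        rcases hb with ⟨rfl, hb⟩ | ⟨hb0, hb1, hb2⟩
        · rw [if_pos ⟨hneg, hb⟩, if_pos rfl]
        · rw [if_neg (by omega), if_neg hb0, hb2]
      obtain ⟨e1, ⟨f0, f1, f2, f3, f4, f5, f6⟩, e3, e4⟩ := hin _ _ _ τ hdel d1 hJτ hlb d5
      rw [if_pos (by omega)]
      generalize inner.eval I τ = ρ at *
      refine ⟨?_, ?_, ?_, _, 0, ?_, hJ _ ρ _ ?_ e1, Or.inl ⟨rfl, ?_⟩⟩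
      · simp [Store.setI, Store.Std, *]
      · simp [Store.setI, *]
      · simp [Store.setI, *]
      · rw [hdel, List.append_assoc]; rfl
      · simp [Store.own, Store.setI]
      · simp [Store.setI]
    · rw [if_neg hturn] at hdel d6
      rw [if_neg (by omega)]
      obtain ⟨f0, f1, f2, f3, f4, f5, f6⟩ := d1
      refine ⟨?_, ?_, ?_, _, _, hdel, hJ _ τ _ ?_ hJτ, ?_⟩
      · simp [Store.setI, Store.Std, *]
      · simp [Store.setI, *]
      · simp [Store.setI, *]
      · simp [Store.own, Store.setI]
      · have e6 : (τ.setI 3 (τ.iv 3 + τ.iv 1)).iv 6 = τ.iv 6 := by simp [Store.setI]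
        have e7 : (τ.setI 3 (τ.iv 3 + τ.iv 1)).rv = τ.rv := rfl
        rw [e6, e7, d7, d8]
        by_cases hneg : I.balance (t + 1) < 0
        · right
          rcases hb with ⟨rfl, hb⟩ | ⟨hb0, hb1, hb2⟩
          · simp [hneg, hb]
          · simp [hneg, hb0, hb1, hb2]
        · rcases hb with ⟨rfl, hb⟩ | ⟨hb0, hb1, hb2⟩
          · left; simp [hneg, hb]
          · right; simp [hneg, hb0, hb1, hb2]
  · rintro σ ⟨⟨h0, -⟩, hi, -⟩
    omega

/-! ### The first pass: overheads -/

/-- Total length of the left movements in triples. -/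
def Barrier.tripleSum (D : List (ℕ × ℕ)) : ℝ :=
  (D.map (fun p => 2 * (I.x p.2 - I.rightTurn p.1))).sum

/-- The index `j` is the least one below `N` that minimizes the overhead. -/
def Barrier.IsBestBelow (N j : ℕ) : Prop :=
  j < N ∧ (∀ i < N, I.overhead j ≤ I.overhead i) ∧ ∀ i < j, I.overhead j < I.overhead i

theorem Barrier.IsBestBelow.eq_bestIndex {I : Barrier} {j : ℕ}
    (h : I.IsBestBelow (I.delimiters.length + 1) j) : j = I.bestIndex := by
  obtain ⟨h1, h2, h3⟩ := h
  obtain ⟨h4, h5⟩ := I.bestIndex_spec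
  refine le_antisymm ?_ (Nat.sInf_le ⟨by omega, fun i hi => h2 i (by omega)⟩)
  by_contra! h6
  linarith [h3 _ h6, h5 j (by omega)]

theorem Barrier.overhead_of_append {D D' : List (ℕ × ℕ)} {d : ℕ × ℕ}
    (h : I.delimiters = D ++ d :: D') :
    I.overhead D.length = I.farPoint - I.rightTurn d.1 + I.tripleSum D := by
  rw [Barrier.overhead, h]
  simp [Barrier.tripleSum]

theorem Barrier.overhead_length :
    I.overhead I.delimiters.length = I.tripleSum I.delimiters := by
  rw [Barrier.overhead]
  simp [Barrier.tripleSum]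

/-- Property maintained by the first pass. -/
def OverheadInv (D : List (ℕ × ℕ)) (σ : Store) : Prop :=
  σ.iv 5 = I.lastMoved ∧ σ.out = [] ∧ σ.iv 7 = D.length ∧
    (1 ≤ I.lastMoved → σ.rv 4 = I.farPoint ∧ σ.rv 7 = I.tripleSum D ∧
      (0 < D.length → σ.rv 8 = I.overhead (σ.iv 8) ∧ I.IsBestBelow D.length (σ.iv 8)))

/-- Only a strict improvement replaces the stored candidate, so ties go to the smaller index. Before
the first comparison the stored values mean nothing; candidate `0` is accepted without a test. -/
theorem eval_update {σ : Store} (hs : σ.Std I) :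
    (Cmd.update.eval I σ).Std I ∧ (∀ v, v ≠ 8 → (Cmd.update.eval I σ).iv v = σ.iv v) ∧
    (∀ v, v ≠ 8 → (Cmd.update.eval I σ).rv v = σ.rv v) ∧
    (Cmd.update.eval I σ).out = σ.out ∧
    (σ.rv 9 = I.overhead (σ.iv 7) →
      (0 < σ.iv 7 → σ.rv 8 = I.overhead (σ.iv 8) ∧ I.IsBestBelow (σ.iv 7) (σ.iv 8)) →
      (Cmd.update.eval I σ).rv 8 = I.overhead ((Cmd.update.eval I σ).iv 8) ∧
      I.IsBestBelow (σ.iv 7 + 1) ((Cmd.update.eval I σ).iv 8)) := by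
  obtain ⟨h0, h1, h2, h3, h4, h5, h6⟩ := hs
  simp only [Cmd.update, Cmd.eval, Store.setI, Store.setR]
  split_ifs with c1 c2
  · refine ⟨by simp [Store.Std, *], fun v hv => by
      simp [hv], fun v hv => by simp [hv], rfl, ?_⟩
    intro h _
    have h7 : σ.iv 7 = 0 := by omega
    refine ⟨by simp [*], ?_⟩
    simp only [Function.update_apply, h3, h7, if_true]
    refine ⟨by omega, fun i hi => ?_, fun i hi => by omega⟩
    rw [show i = 0 by omega]
  · refine ⟨⟨h0, h1, h2, h3, h4, h5, h6⟩, fun _ _ => rfl, fun _ _ => rfl, rfl, ?_⟩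
    intro h hb
    obtain ⟨b1, b2, b3, b4⟩ := hb (by omega)
    refine ⟨b1, by omega, fun i hi => ?_, b4⟩
    rcases eq_or_lt_of_le (Nat.lt_succ_iff.1 hi) with hi | hi
    · rw [hi, ← h, ← b1]; exact c2
    · exact b3 i hi
  · refine ⟨by simp [Store.Std, *], fun v hv => by
      simp [hv], fun v hv => by simp [hv], rfl, ?_⟩
    intro h hb
    obtain ⟨b1, b2, b3, b4⟩ := hb (by omega)
    rw [b1, h, not_le] at c2
    refine ⟨by simp [*], ?_⟩
    simp only [Function.update_apply, h3, if_true, add_zero]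
    refine ⟨by omega, fun i hi => ?_, fun i hi => ?_⟩
    · rcases eq_or_lt_of_le (Nat.lt_succ_iff.1 hi) with hi | hi
      · rw [hi]
      · exact c2.le.trans (b3 i hi)
    · exact c2.trans_le (b3 i hi)

theorem hoare_overhead : Hoare I
    (fun σ => ScanReady I σ ∧ OverheadInv I [] σ)
    (Code.loop 3 0 (Cmd.scanBody Cmd.overheadBody).code)
    (fun σ => σ.Std I ∧ OverheadInv I I.delimiters σ)
    (I.n * ((Cmd.scanBody Cmd.overheadBody).cost + 2) + 2) := by
  refine hoare_scan I _ (OverheadInv I) ?_ ?_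
  · intro D σ σ' h hJ
    simp only [Store.own, Prod.mk.injEq] at h
    obtain ⟨h1, h2, h3, h4, h5, h6, h7⟩ := h
    simp only [OverheadInv] at hJ ⊢
    rwa [← h1, ← h2, ← h3, ← h4, ← h5, ← h6, ← h7]
  · rintro D d D' σ hdel ⟨h0, h1, h2, h3, h4, h5, h6⟩ ⟨j1, j2, j3, j4⟩ hlb hx
    simp only [Cmd.overheadBody, Cmd.eval]
    have hov := I.overhead_of_append hdel
    set τ := (σ.setR 9 (σ.rv 4 - σ.rv 6)).setR 9 ((σ.setR 9 (σ.rv 4 - σ.rv 6)).rv 9 +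
      (σ.setR 9 (σ.rv 4 - σ.rv 6)).rv 7) with hτ
    have t1 : τ.Std I := by
      simp [Store.setR, Store.Std, *]
    have t2 : τ.iv = σ.iv := rfl
    have t3 : ∀ v, v ≠ 9 → τ.rv v = σ.rv v := fun v hv => by
      simp [hτ, Store.setR, hv]
    have t4 : τ.rv 9 = σ.rv 4 - σ.rv 6 + σ.rv 7 := by
      simp [hτ, Store.setR]
    have t5 : τ.out = σ.out := rfl
    clear_value τ
    obtain ⟨⟨g0, g1, g2, g3, g4, g5, g6⟩, u2, u3, u4, u5⟩ := eval_update I t1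
    generalize Cmd.update.eval I τ = ρ at *
    have v5 : ρ.rv 5 = I.x d.2 := by rw [u3 5 (by decide), t3 5 (by decide), hx]
    have v6 : ρ.rv 6 = I.rightTurn d.1 := by rw [u3 6 (by decide), t3 6 (by decide), hlb]
    have v4 : ρ.rv 4 = σ.rv 4 := by rw [u3 4 (by decide), t3 4 (by decide)]
    have v7 : ρ.rv 7 = σ.rv 7 := by rw [u3 7 (by decide), t3 7 (by decide)]
    have v3 : ρ.rv 3 = σ.rv 3 := by rw [u3 3 (by decide), t3 3 (by decide)]
    have w3 : ρ.iv 3 = σ.iv 3 := by rw [u2 3 (by decide), t2]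
    have w5 : ρ.iv 5 = I.lastMoved := by rw [u2 5 (by decide), t2, j1]
    have w7 : ρ.iv 7 = D.length := by rw [u2 7 (by decide), t2, j3]
    refine ⟨⟨?_, ?_, ?_, fun hk => ?_⟩, ?_, ?_, ?_⟩
    · simpa [Store.setI, Store.setR] using w5
    · simp [Store.setI, Store.setR, u4, t5, j2]
    · simp [Store.setI, Store.setR, w7, g1]
    · obtain ⟨k1, k2, k3⟩ := j4 hk
      rw [t2, t3 8 (by decide), j3] at u5
      obtain ⟨b1, b2⟩ := u5 (by rw [t4, hov, k1, hlb, k2]) k3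
      refine ⟨by simp [Store.setI, Store.setR, v4, k1], ?_, fun _ => ?_⟩
      · simp [Store.setI, Store.setR, v7, v5, v6, k2, Barrier.tripleSum]
        ring
      · simpa [Store.setI, Store.setR] using ⟨b1, b2⟩
    · simp [Store.setI, Store.setR, Store.Std, *]
    · simpa [Store.setI, Store.setR] using w3
    · simpa [Store.setI, Store.setR] using v3

/-! ### The second pass: output -/

/-- What the second pass has emitted after the delimiters in the list. -/
def Barrier.emitted (D : List (ℕ × ℕ)) : List ℝ :=
  (D.take I.bestIndex).flatMap (fun p => [I.x p.2, I.rightTurn p.1]) ++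
    match D[I.bestIndex]? with
    | some p => [I.farPoint, I.rightTurn p.1]
    | none => []

/-- Property maintained by the second pass. -/
def EmitInv (D : List (ℕ × ℕ)) (σ : Store) : Prop :=
  σ.iv 5 = I.lastMoved ∧ σ.iv 7 = D.length ∧ (I.lastMoved = 0 → σ.out = []) ∧
    (1 ≤ I.lastMoved → σ.rv 4 = I.farPoint ∧ σ.iv 8 = I.bestIndex ∧ σ.out = I.emitted D)

theorem hoare_overheadEnd : Hoare I (fun σ => σ.Std I ∧ OverheadInv I I.delimiters σ)
    Cmd.overheadEnd.code (fun σ => ScanReady I σ ∧ EmitInv I [] σ) Cmd.overheadEnd.cost := by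
  refine Hoare.cmd ?_
  rintro σ ⟨⟨h0, h1, h2, h3, h4, h5, h6⟩, j1, j2, j3, j4⟩
  simp only [Cmd.overheadEnd, Cmd.scanStart, Cmd.eval]
  set τ := σ.setR 9 (σ.rv 7 + σ.rv 0) with hτ
  have t1 : τ.Std I := by
    simp [Store.setR, Store.Std, *]
  have t2 : τ.iv = σ.iv := rfl
  have t3 : ∀ v, v ≠ 9 → τ.rv v = σ.rv v := fun v hv => by
    simp [hτ, Store.setR, hv]
  have t4 : τ.rv 9 = σ.rv 7 := by
    simp [hτ, Store.setR, h4]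
  have t5 : τ.out = σ.out := rfl
  clear_value τ
  obtain ⟨⟨g0, g1, g2, g3, g4, g5, g6⟩, u2, u3, u4, u5⟩ := eval_update I t1
  generalize Cmd.update.eval I τ = ρ at *
  have hr0 : I.rightTurn 0 = -I.r := by rw [I.rightTurn_eq]; simp
  have w5 : ρ.iv 5 = I.lastMoved := by rw [u2 5 (by decide), t2, j1]
  have v4 : ρ.rv 4 = σ.rv 4 := by rw [u3 4 (by decide), t3 4 (by decide)]
  refine ⟨⟨?_, ?_, ?_, ?_⟩, ?_, ?_, fun hk => ?_, fun hk => ?_⟩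
  · simp [Store.setI, Store.setR, Store.Std, *]
  · simp [Store.setI, Store.setR]
  · simp [Store.setI, Store.setR, g4, g5, hr0]
  · simp [Store.setI, Store.setR]
  · simpa [Store.setI, Store.setR] using w5
  · simp [Store.setI, Store.setR]
  · simp [Store.setI, Store.setR, u4, t5, j2]
  · obtain ⟨k1, k2, k3⟩ := j4 hk
    rw [t2, t3 8 (by decide), j3] at u5
    obtain ⟨b1, b2⟩ := u5 (by rw [t4, k2, I.overhead_length]) k3
    refine ⟨?_, ?_, ?_⟩
    · simp [Store.setI, Store.setR, v4, k1]
    · simpa [Store.setI, Store.setR] using b2.eq_bestIndex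
    · simp [Store.setI, Store.setR, u4, t5, j2, Barrier.emitted]

/-- The three cases are those of the command `emitBody`: a pair after the best index yields nothing,
the pair at it a double, an earlier pair a triple. -/
theorem Barrier.emitted_append (D : List (ℕ × ℕ)) (d : ℕ × ℕ) :
    I.emitted (D ++ [d]) = I.emitted D ++
      if I.bestIndex ≤ D.length then
        if D.length ≤ I.bestIndex then [I.farPoint, I.rightTurn d.1] else []
      else [I.x d.2, I.rightTurn d.1] := by
  rcases lt_trichotomy I.bestIndex D.length with h | h | h
  · simp [Barrier.emitted, h.le, h.not_ge, List.take_append, h,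
      Nat.sub_eq_zero_of_le h.le]
  · simp [Barrier.emitted, h]
  · have h1 : D.take I.bestIndex = D := List.take_of_length_le h.le
    have h2 : (D ++ [d]).take I.bestIndex = D ++ [d] := List.take_of_length_le (by simpa using h)
    have h3 : D[I.bestIndex]? = none := List.getElem?_eq_none h.le
    simp [Barrier.emitted, h1, h2, h3, h.not_ge]

theorem hoare_emit : Hoare I
    (fun σ => ScanReady I σ ∧ EmitInv I [] σ) (Code.loop 3 0 (Cmd.scanBody Cmd.emitBody).code)
    (fun σ => σ.Std I ∧ EmitInv I I.delimiters σ)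
    (I.n * ((Cmd.scanBody Cmd.emitBody).cost + 2) + 2) := by
  refine hoare_scan I _ (EmitInv I) ?_ ?_
  · intro D σ σ' h hJ
    simp only [Store.own, Prod.mk.injEq] at h
    obtain ⟨h1, h2, h3, h4, h5, h6, h7⟩ := h
    simp only [EmitInv] at hJ ⊢
    rwa [← h1, ← h2, ← h3, ← h4, ← h7]
  · rintro D d D' σ hdel ⟨h0, h1, h2, h3, h4, h5, h6⟩ ⟨j1, j2, j3, j4⟩ hlb hx
    simp only [Cmd.emitBody, Cmd.eval, h1, j1]
    rcases Nat.eq_zero_or_pos I.lastMoved with hk | hk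
    · have hk' : ¬ 1 ≤ I.lastMoved := by omega
      simp [EmitInv, Store.Std, Store.setI, *]
    · obtain ⟨k1, k2, k3⟩ := j4 hk
      have hk0 : I.lastMoved ≠ 0 := by omega
      rw [if_pos (show 1 ≤ I.lastMoved from hk)]
      have hem := I.emitted_append D d
      by_cases c1 : I.bestIndex ≤ D.length
      · by_cases c2 : D.length ≤ I.bestIndex
        · rw [if_pos c1, if_pos c2] at hem
          simp [EmitInv, Store.Std, Store.setI, *]
        · rw [if_pos c1, if_neg c2] at hem
          simp [EmitInv, Store.Std, Store.setI, *]
      · rw [if_neg c1] at hem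
        simp [EmitInv, Store.Std, Store.setI, *]

theorem hoare_emitEnd : Hoare I (fun σ => σ.Std I ∧ EmitInv I I.delimiters σ)
    Cmd.emitEnd.code (fun σ => σ.out = I.offline) Cmd.emitEnd.cost := by
  refine Hoare.cmd ?_
  rintro σ ⟨⟨h0, h1, h2, h3, h4, h5, h6⟩, j1, j2, j3, j4⟩
  simp only [Cmd.emitEnd, Cmd.eval, h1, j1]
  rcases Nat.eq_zero_or_pos I.lastMoved with hk | hk
  · rw [if_neg (by omega), j3 hk, I.offline_of_covered (I.covered_iff.2 hk)]
  · obtain ⟨k1, k2, k3⟩ := j4 hk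
    rw [I.offline_of_not_covered (fun h => by have := I.covered_iff.1 h; omega),
      if_pos (show 1 ≤ I.lastMoved from hk), j2, k2, k1, Barrier.trajectory]
    rcases eq_or_lt_of_le I.bestIndex_spec.1 with h | h
    · rw [if_pos h.ge, k3, Barrier.emitted, List.getElem?_eq_none h.ge]
      simp
    · rw [if_neg (by omega), k3, Barrier.emitted, List.getElem?_eq_getElem h]

/-- The code after initialization. -/
def offlineCode : Code :=
  Code.seq Cmd.start.code <| Code.seq (Code.loop 3 0 Cmd.sumBody.code) <|
  Code.seq Cmd.gapStart.code <| Code.seq (Code.loop 1 3 Cmd.gapBody.code) <|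
  Code.seq Cmd.farCmd.code <|
  Code.seq (Code.loop 3 0 (Cmd.scanBody Cmd.overheadBody).code) <|
  Code.seq Cmd.overheadEnd.code <|
  Code.seq (Code.loop 3 0 (Cmd.scanBody Cmd.emitBody).code) Cmd.emitEnd.code

theorem exists_linear_time_program : ∃ (P : List Instr) (K : ℕ), ∀ I : Barrier,
    Computes P I I.offline (K * I.n) := by
  refine ⟨initCode 9 ++ offlineCode 12, 1000, fun I => ?_⟩
  -- With no pair found yet, the sum of the triples is empty and there is no candidate to compare
  -- with.
  have hmid : ∀ {C Post T}, Hoare I (fun σ => ScanReady I σ ∧ OverheadInv I [] σ) C Post T →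
      Hoare I (fun σ => ScanReady I σ ∧ σ.iv 5 = I.lastMoved ∧ σ.out = [] ∧ σ.iv 7 = 0 ∧
        σ.rv 7 = 0 ∧ (1 ≤ I.lastMoved → σ.rv 4 = I.farPoint)) C Post T := by
    rintro C Post T h σ ⟨h1, h2, h3, h4, h5, h6⟩
    exact h σ ⟨h1, h2, h3, h4, fun hk => ⟨h6 hk, by simp [h5, Barrier.tripleSum], by simp⟩⟩
  have h := (hoare_start I).seq <| (hoare_sum I).seq <| (hoare_gapStart I).seq <|
    (hoare_gap I).seq <| (hoare_far I).seq <| hmid <| (hoare_overhead I).seq <|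
    (hoare_overheadEnd I).seq <| (hoare_emit I).seq (hoare_emitEnd I)
  obtain ⟨t, ht, h⟩ := h.computes
  refine ⟨t, ht.trans ?_, h⟩
  -- The step count is affine in `n`; since `n ≥ 1`, the generous factor `1000` absorbs the constant
  -- term.
  have hn := I.one_le_n
  simp only [Cmd.start, Cmd.sumBody, Cmd.gapStart, Cmd.gapBody, Cmd.scanStart, Cmd.farCmd,
    Cmd.detect, Cmd.scanBody, Cmd.update, Cmd.overheadBody, Cmd.overheadEnd, Cmd.emitBody,
    Cmd.emitEnd, Cmd.cost]
  omega

end BarrierRobot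

end

theorem mainTheorem1 :
    -- Offline runs in linear time
    (∃ (P : List BarrierRobot.Instr) (K : ℕ), ∀ I : BarrierRobot.Barrier,
      BarrierRobot.Computes P I I.offline (K * I.n)) ∧
    ∀ I : BarrierRobot.Barrier,
      -- the trajectory that it computes restores coverage and has minimum length
      I.IsOptimal I.offline ∧
      -- it produces an order-preserving, fully stretched solution
      (∃ y, I.Produces I.offline y ∧ I.Covered y ∧ I.OrderPreserving y ∧
        I.FullyStretched I.offline y) ∧
      -- if there are gaps, it consists of disjoint triples at the first `j` potential
      -- delimiters, followed by a straight line segment (`j = m`) or a final double (`j < m`)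
      (¬ I.Covered I.x → ∃ j ≤ I.delimiters.length,
        I.offline = I.trajectory j ∧ (0 :: I.breakpoints j).Pairwise (· < ·) ∧
        BarrierRobot.pathLength 0 I.offline = I.farPoint + I.overhead j ∧
        ∀ i ≤ I.delimiters.length, I.overhead j ≤ I.overhead i) :=
  ⟨BarrierRobot.exists_linear_time_program, fun I => I.offline_correct⟩
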